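/- Let $\Omega\subset\mathbb R^2$ be a bounded Lipschitz domain, let $K\subset\Omega$ be a measurable set of positive Lebesgue measure, and let $\lambda>0$ and $s>1$ be fixed real numbers. Let $W^{1,2}(\Omega)$ be the Sobolev space of real functions $u\in L^2(\Omega)$ with weak gradient $\nabla u\in L^2(\Omega;\mathbb R^2)$, normed by $\|u\|_{W^{1,2}(\Omega)}^2=\|u\|_{L^2(\Omega)}^2+\|\nabla u\|_{L^2(\Omega)}^2$, and let $W^{1,2}_0(\Omega)$ be the closure of $C_c^\infty(\Omega)$ in $W^{1,2}(\Omega)$, with the same norm. Then for every $w\in W^{1,2}(\Omega)$ the minimization problem $$\int_\Omega|\nabla u|^2\,dx+\lambda\int_K|u-w|^s\,dx\ \to\ \min\quad\text{in } W^{1,2}_0(\Omega)$$ has exactly one solution $u=:I(w)$, and the resulting inpainting operator $$I:\ W^{1,2}(\Omega)\to W^{1,2}_0(\Omega),\qquad w\mapsto I(w),$$ is continuous with respect to the $W^{1,2}$ norms. -/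

import Mathlib

open MeasureTheory
open scoped ENNReal NNReal ContDiff

noncomputable section

namespace Inpainting

/-- The Euclidean plane. -/
abbrev Plane : Type := EuclideanSpace ℝ (Fin 2)

/-- A Lipschitz domain in the plane: a nonempty, open, connected set which, near each of its
boundary points and in suitable Cartesian coordinates, is the region strictly above the graph of a
Lipschitz function. (A translation of the coordinates is absorbed into the function.) -/
structure IsLipschitzDomain (Ω : Set Plane) : Prop where
  isOpen : IsOpen Ω
  isConnected : IsConnected Ω
  locally_graph : ∀ x₀ ∈ frontier Ω, ∃ r : ℝ, 0 < r ∧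
    ∃ (e : Plane ≃ₗᵢ[ℝ] Plane) (γ : ℝ → ℝ) (L : ℝ≥0), LipschitzWith L γ ∧
      ∀ x ∈ Metric.ball x₀ r, (x ∈ Ω ↔ γ (e x 0) < e x 1)

/-- The class `C_c^∞(Ω)`. -/
structure IsTestFunction (Ω : Set Plane) (φ : Plane → ℝ) : Prop where
  smooth : ContDiff ℝ ∞ φ
  hasCompactSupport : HasCompactSupport φ
  tsupport_subset : tsupport φ ⊆ Ω

/-- The `i`-th partial derivative. -/
def partialDeriv (i : Fin 2) (φ : Plane → ℝ) (x : Plane) : ℝ :=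
  fderiv ℝ φ x (EuclideanSpace.single i 1)

/-- `G` is the weak (distributional) gradient of `u` on `Ω`. -/
def HasWeakGradient (Ω : Set Plane) (u : Plane → ℝ) (G : Plane → Plane) : Prop :=
  ∀ φ : Plane → ℝ, IsTestFunction Ω φ → ∀ i : Fin 2,
    ∫ x in Ω, u x * partialDeriv i φ x = - ∫ x in Ω, G x i * φ x

/-- The ambient Hilbert space `L²(Ω) × L²(Ω; ℝ²)` with the norm
`‖(u, G)‖² = ‖u‖²_{L²} + ‖G‖²_{L²}`. -/
abbrev L2Pair (Ω : Set Plane) : Type :=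
  WithLp 2 (Lp ℝ 2 (volume.restrict Ω) × Lp Plane 2 (volume.restrict Ω))

lemma IsTestFunction.memLp {Ω : Set Plane} {φ : Plane → ℝ} (h : IsTestFunction Ω φ) :
    MemLp φ 2 (volume.restrict Ω) :=
  (h.smooth.continuous.memLp_of_hasCompactSupport h.hasCompactSupport).restrict Ω

lemma IsTestFunction.memLp_partialDeriv {Ω : Set Plane} {φ : Plane → ℝ}
    (h : IsTestFunction Ω φ) (i : Fin 2) :
    MemLp (partialDeriv i φ) 2 (volume.restrict Ω) := by
  have h1 : Continuous (partialDeriv i φ) :=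
    (h.smooth.continuous_fderiv (by simp)).clm_apply continuous_const
  have h2 : HasCompactSupport (partialDeriv i φ) :=
    h.hasCompactSupport.fderiv_apply (𝕜 := ℝ) _
  exact (h1.memLp_of_hasCompactSupport h2).restrict Ω

lemma memLp_coord {Ω : Set Plane} (G : Lp Plane 2 (volume.restrict Ω)) (i : Fin 2) :
    MemLp (fun x => G x i) 2 (volume.restrict Ω) :=
  (EuclideanSpace.proj (𝕜 := ℝ) i).comp_memLp' (Lp.memLp G)

lemma integrable_mul_partialDeriv {Ω : Set Plane} (u : Lp ℝ 2 (volume.restrict Ω))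
    {φ : Plane → ℝ} (h : IsTestFunction Ω φ) (i : Fin 2) :
    Integrable (fun x => u x * partialDeriv i φ x) (volume.restrict Ω) :=
  (Lp.memLp u).integrable_mul (h.memLp_partialDeriv i)

lemma integrable_coord_mul {Ω : Set Plane} (G : Lp Plane 2 (volume.restrict Ω))
    {φ : Plane → ℝ} (h : IsTestFunction Ω φ) (i : Fin 2) :
    Integrable (fun x => G x i * φ x) (volume.restrict Ω) :=
  (memLp_coord G i).integrable_mul h.memLp

/-- The Sobolev space `W^{1,2}(Ω)`: all `u ∈ L²(Ω)` having a weak gradient in `L²(Ω; ℝ²)`.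
An element is stored as the pair `(u, ∇u)`, and the weak gradient is determined by `u`
(see `W12.ext`), so that the norm inherited from the ambient space is the usual one,
`‖u‖² = ‖u‖²_{L²} + ‖∇u‖²_{L²}`. -/
def W12 (Ω : Set Plane) : Submodule ℝ (L2Pair Ω) where
  carrier := {p | HasWeakGradient Ω p.fst p.snd}
  zero_mem' := by
    intro φ _ i
    have h1 : ∫ x in Ω, (0 : L2Pair Ω).fst x * partialDeriv i φ x = 0 := by
      apply integral_eq_zero_of_ae
      filter_upwards [Lp.coeFn_zero ℝ 2 (volume.restrict Ω)] with x hx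
      rw [WithLp.zero_fst, hx]
      simp
    have h2 : ∫ x in Ω, (0 : L2Pair Ω).snd x i * φ x = 0 := by
      apply integral_eq_zero_of_ae
      filter_upwards [Lp.coeFn_zero Plane 2 (volume.restrict Ω)] with x hx
      rw [WithLp.zero_snd, hx]
      simp
    rw [h1, h2, neg_zero]
  add_mem' := by
    intro p q hp hq φ hφ i
    have h1 : ∫ x in Ω, (p + q).fst x * partialDeriv i φ x
        = (∫ x in Ω, p.fst x * partialDeriv i φ x) + ∫ x in Ω, q.fst x * partialDeriv i φ x := by
      rw [← integral_add (integrable_mul_partialDeriv p.fst hφ i)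
        (integrable_mul_partialDeriv q.fst hφ i)]
      apply integral_congr_ae
      filter_upwards [Lp.coeFn_add p.fst q.fst] with x hx
      rw [WithLp.add_fst, hx]
      simp [add_mul]
    have h2 : ∫ x in Ω, (p + q).snd x i * φ x
        = (∫ x in Ω, p.snd x i * φ x) + ∫ x in Ω, q.snd x i * φ x := by
      rw [← integral_add (integrable_coord_mul p.snd hφ i)
        (integrable_coord_mul q.snd hφ i)]
      apply integral_congr_ae
      filter_upwards [Lp.coeFn_add p.snd q.snd] with x hx
      rw [WithLp.add_snd, hx]
      simp [add_mul]
    rw [h1, h2, hp φ hφ i, hq φ hφ i, neg_add]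
  smul_mem' := by
    intro c p hp φ hφ i
    have h1 : ∫ x in Ω, (c • p).fst x * partialDeriv i φ x
        = c * ∫ x in Ω, p.fst x * partialDeriv i φ x := by
      rw [← integral_const_mul]
      apply integral_congr_ae
      filter_upwards [Lp.coeFn_smul c p.fst] with x hx
      simp [hx, mul_assoc]
    have h2 : ∫ x in Ω, (c • p).snd x i * φ x = c * ∫ x in Ω, p.snd x i * φ x := by
      rw [← integral_const_mul]
      apply integral_congr_ae
      filter_upwards [Lp.coeFn_smul c p.snd] with x hx
      simp [hx, mul_assoc]
    rw [h1, h2, hp φ hφ i, mul_neg]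

/-- The function underlying an element of `W^{1,2}(Ω)`. -/
def W12.fn {Ω : Set Plane} (u : W12 Ω) : Plane → ℝ := u.1.fst

/-- The weak gradient of an element of `W^{1,2}(Ω)`. -/
def W12.grad {Ω : Set Plane} (u : W12 Ω) : Plane → Plane := u.1.snd

/-- On an open set, an element of `W^{1,2}(Ω)` is determined by its underlying function. -/
lemma W12.ext {Ω : Set Plane} (hΩ : IsOpen Ω) {u v : W12 Ω}
    (h : W12.fn u =ᵐ[volume.restrict Ω] W12.fn v) : u = v := by
  have h1 : u.1.fst = v.1.fst := Lp.ext h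
  have hc : ∀ i : Fin 2, ∀ᵐ x ∂volume, x ∈ Ω → u.1.snd x i - v.1.snd x i = 0 := by
    intro i
    have hm : MemLp (fun x => u.1.snd x i - v.1.snd x i) 2 (volume.restrict Ω) :=
      (memLp_coord u.1.snd i).sub (memLp_coord v.1.snd i)
    have hloc : LocallyIntegrableOn (fun x => u.1.snd x i - v.1.snd x i) Ω volume :=
      locallyIntegrableOn_of_locallyIntegrable_restrict (hm.locallyIntegrable (by norm_num))
    refine hΩ.ae_eq_zero_of_integral_contDiff_smul_eq_zero hloc ?_
    intro φ hφ1 hφ2 hφ3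
    have hφ : IsTestFunction Ω φ := ⟨hφ1, hφ2, hφ3⟩
    have e1 : ∫ x, φ x • (u.1.snd x i - v.1.snd x i)
        = ∫ x in Ω, φ x • (u.1.snd x i - v.1.snd x i) := by
      refine (setIntegral_eq_integral_of_forall_compl_eq_zero fun x hx => ?_).symm
      rw [image_eq_zero_of_notMem_tsupport fun hh => hx (hφ3 hh), zero_smul]
    have e2 : ∫ x in Ω, φ x • (u.1.snd x i - v.1.snd x i)
        = (∫ x in Ω, u.1.snd x i * φ x) - ∫ x in Ω, v.1.snd x i * φ x := by
      rw [← integral_sub (integrable_coord_mul u.1.snd hφ i)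
        (integrable_coord_mul v.1.snd hφ i)]
      refine integral_congr_ae (Filter.Eventually.of_forall fun x => ?_)
      simp only [smul_eq_mul]
      ring
    have hu := u.2 φ hφ i
    have hv := v.2 φ hφ i
    rw [h1] at hu
    rw [e1, e2]
    linarith
  have h2 : u.1.snd = v.1.snd := by
    refine Lp.ext ?_
    rw [Filter.EventuallyEq, ae_restrict_iff' hΩ.measurableSet]
    filter_upwards [hc 0, hc 1] with x hx0 hx1 hx
    ext i
    fin_cases i
    · exact sub_eq_zero.mp (hx0 hx)
    · exact sub_eq_zero.mp (hx1 hx)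
  refine Subtype.ext ?_
  apply (WithLp.equiv 2 _).injective
  exact Prod.ext h1 h2

/-- The subspace of `W^{1,2}(Ω)` formed by (the classes of) the test functions on `Ω`. -/
def testSubspace (Ω : Set Plane) : Submodule ℝ (W12 Ω) where
  carrier := {u | ∃ φ : Plane → ℝ, IsTestFunction Ω φ ∧ W12.fn u =ᵐ[volume.restrict Ω] φ}
  zero_mem' := by
    refine ⟨0, ⟨contDiff_const, HasCompactSupport.zero, by simp [tsupport]⟩, ?_⟩
    exact Lp.coeFn_zero ℝ 2 (volume.restrict Ω)
  add_mem' := by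
    rintro u v ⟨φ, hφ, hu⟩ ⟨ψ, hψ, hv⟩
    refine ⟨φ + ψ, ⟨hφ.smooth.add hψ.smooth, hφ.hasCompactSupport.add hψ.hasCompactSupport,
      (tsupport_add φ ψ).trans (Set.union_subset hφ.tsupport_subset hψ.tsupport_subset)⟩, ?_⟩
    exact (Lp.coeFn_add u.1.fst v.1.fst).trans (hu.add hv)
  smul_mem' := by
    rintro c u ⟨φ, hφ, hu⟩
    refine ⟨c • φ, ⟨hφ.smooth.const_smul c, hφ.hasCompactSupport.smul_left (f := fun _ => c),
      (tsupport_smul_subset_right (fun _ => c) φ).trans hφ.tsupport_subset⟩, ?_⟩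
    exact (Lp.coeFn_smul c u.1.fst).trans (hu.const_smul c)

/-- The Sobolev space `W₀^{1,2}(Ω)`: the closure of `C_c^∞(Ω)` in `W^{1,2}(Ω)`, with the norm of
`W^{1,2}(Ω)`. -/
def W012 (Ω : Set Plane) : Submodule ℝ (W12 Ω) := (testSubspace Ω).topologicalClosure

/-- The energy `∫_Ω |∇v|² + lam ∫_K |v - w|^s`, with values in `[0, ∞]`. -/
def energy (Ω K : Set Plane) (lam s : ℝ) (w v : W12 Ω) : ℝ≥0∞ :=
  (∫⁻ x in Ω, ‖W12.grad v x‖ₑ ^ 2) + ENNReal.ofReal lam * ∫⁻ x in K, ‖W12.fn v x - W12.fn w x‖ₑ ^ s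

/-- `u` minimizes the energy with datum `w` among all functions of `W₀^{1,2}(Ω)`. -/
def IsMinimizer (Ω K : Set Plane) (lam s : ℝ) (w : W12 Ω) (u : W012 Ω) : Prop :=
  ∀ v : W012 Ω, energy Ω K lam s w u ≤ energy Ω K lam s w v

end Inpainting

end

open Inpainting

namespace Inpainting

open Filter Topology

/-- The Cauchy–Schwarz inequality for lower Lebesgue integrals, in squared form. -/
lemma sq_lintegral_mul_le {α : Type*} [MeasurableSpace α] (μ : Measure α) {f g : α → ℝ≥0∞}
    (hf : AEMeasurable f μ) (hg : AEMeasurable g μ) :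
    (∫⁻ x, f x * g x ∂μ) ^ 2 ≤ (∫⁻ x, f x ^ 2 ∂μ) * ∫⁻ x, g x ^ 2 ∂μ := by
  have h := ENNReal.lintegral_mul_le_Lp_mul_Lq μ Real.HolderConjugate.two_two hf hg
  simp only [Pi.mul_apply, ENNReal.rpow_two] at h
  calc (∫⁻ x, f x * g x ∂μ) ^ 2
      ≤ ((∫⁻ x, f x ^ 2 ∂μ) ^ (1 / (2 : ℝ)) * (∫⁻ x, g x ^ 2 ∂μ) ^ (1 / (2 : ℝ))) ^ 2 := by gcongr
    _ = _ := by
      rw [mul_pow, ← ENNReal.rpow_two, ← ENNReal.rpow_two, ← ENNReal.rpow_mul, ← ENNReal.rpow_mul]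
      norm_num

/-- Gagliardo's inequality on a subset of the plane which is stable under subtracting vectors of
the first quadrant. -/
lemma lintegral_sq_le_of_quadrant {W : Set (ℝ × ℝ)} (hWm : MeasurableSet W)
    (hW : ∀ z ∈ W, ∀ p q : ℝ, 0 ≤ p → 0 ≤ q → z - (p, q) ∈ W) {f : ℝ × ℝ → ℝ}
    (hf : ContDiff ℝ 1 f) (hfc : HasCompactSupport f) :
    ∫⁻ z in W, ‖f z‖ₑ ^ 2 ≤
      (∫⁻ z in W, ‖fderiv ℝ f z (1, 0)‖ₑ) * ∫⁻ z in W, ‖fderiv ℝ f z (0, 1)‖ₑ := by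
  have hcd : Continuous (fderiv ℝ f) := hf.continuous_fderiv one_ne_zero
  have hdf : Differentiable ℝ f := hf.differentiable one_ne_zero
  set g₁ : ℝ × ℝ → ℝ≥0∞ := W.indicator fun z => ‖fderiv ℝ f z (1, 0)‖ₑ with hg₁
  set g₂ : ℝ × ℝ → ℝ≥0∞ := W.indicator fun z => ‖fderiv ℝ f z (0, 1)‖ₑ with hg₂
  have hm₁ : Measurable g₁ :=
    ((hcd.clm_apply continuous_const).measurable.enorm).indicator hWm
  have hm₂ : Measurable g₂ :=
    ((hcd.clm_apply continuous_const).measurable.enorm).indicator hWm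
  have b₁ : ∀ x y, (x, y) ∈ W → ‖f (x, y)‖ₑ ≤ ∫⁻ t, g₁ (t, y) := by
    intro x y hxy
    have hd : ∀ t, HasDerivAt (fun t : ℝ => f (t, y)) (fderiv ℝ f (t, y) (1, 0)) t := fun t =>
      (hdf (t, y)).hasFDerivAt.comp_hasDerivAt t ((hasDerivAt_id t).prodMk (hasDerivAt_const t y))
    have h := HasCompactSupport.enorm_le_lintegral_Ici_deriv (f := fun t : ℝ => f (t, y))
      (hf.comp (contDiff_id.prodMk contDiff_const))
      (hfc.comp_isClosedEmbedding (g := fun t : ℝ => (t, y)) (.of_continuous_injective_isClosedMap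
        (by fun_prop) (fun a b h => (Prod.ext_iff.1 h).1)
        (isClosedMap_prodMk_right y))) x
    refine h.trans ?_
    rw [← lintegral_indicator measurableSet_Iic]
    refine lintegral_mono fun t => ?_
    by_cases ht : t ∈ Set.Iic x
    · have : (t, y) ∈ W := by
        simpa using hW _ hxy (x - t) 0 (sub_nonneg.2 ht) le_rfl
      simp [ht, hg₁, this, (hd t).deriv]
    · simp [ht]
  have b₂ : ∀ x y, (x, y) ∈ W → ‖f (x, y)‖ₑ ≤ ∫⁻ t, g₂ (x, t) := by
    intro x y hxy
    have hd : ∀ t, HasDerivAt (fun t : ℝ => f (x, t)) (fderiv ℝ f (x, t) (0, 1)) t := fun t =>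
      (hdf (x, t)).hasFDerivAt.comp_hasDerivAt t ((hasDerivAt_const t x).prodMk (hasDerivAt_id t))
    have h := HasCompactSupport.enorm_le_lintegral_Ici_deriv (f := fun t : ℝ => f (x, t))
      (hf.comp (contDiff_const.prodMk contDiff_id))
      (hfc.comp_isClosedEmbedding (g := fun t : ℝ => (x, t)) (.of_continuous_injective_isClosedMap
        (by fun_prop) (fun a b h => (Prod.ext_iff.1 h).2)
        (isClosedMap_prodMk_left x))) y
    refine h.trans ?_
    rw [← lintegral_indicator measurableSet_Iic]
    refine lintegral_mono fun t => ?_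
    by_cases ht : t ∈ Set.Iic y
    · have : (x, t) ∈ W := by
        simpa using hW _ hxy 0 (y - t) le_rfl (sub_nonneg.2 ht)
      simp [ht, hg₂, this, (hd t).deriv]
    · simp [ht]
  calc ∫⁻ z in W, ‖f z‖ₑ ^ 2
      = ∫⁻ z, W.indicator (fun z => ‖f z‖ₑ ^ 2) z := (lintegral_indicator hWm _).symm
    _ ≤ ∫⁻ z : ℝ × ℝ, (∫⁻ t, g₂ (z.1, t)) * ∫⁻ t, g₁ (t, z.2) := by
      refine lintegral_mono fun z => ?_
      by_cases hz : z ∈ W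
      · simp only [hz, Set.indicator_of_mem, sq]
        exact mul_le_mul' (b₂ z.1 z.2 hz) (b₁ z.1 z.2 hz)
      · simp [hz]
    _ = (∫⁻ x, ∫⁻ t, g₂ (x, t)) * ∫⁻ y, ∫⁻ t, g₁ (t, y) := by
      rw [Measure.volume_eq_prod]
      exact lintegral_prod_mul hm₂.lintegral_prod_right'.aemeasurable
        hm₁.lintegral_prod_left'.aemeasurable
    _ = (∫⁻ z, g₂ z) * ∫⁻ z, g₁ z := by
      rw [Measure.volume_eq_prod, lintegral_prod _ hm₂.aemeasurable,
        lintegral_prod_symm _ hm₁.aemeasurable]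
    _ = _ := by rw [hg₁, hg₂, lintegral_indicator hWm, lintegral_indicator hWm, mul_comm]

/-- `U` is stable under subtracting vectors of the sector `A([0, ∞)²)`. -/
def IsSectorStable (A : (ℝ × ℝ) ≃L[ℝ] Plane) (U : Set Plane) : Prop :=
  ∀ x ∈ U, ∀ p q : ℝ, 0 ≤ p → 0 ≤ q → x - A (p, q) ∈ U

lemma exists_lintegral_eq_mul_lintegral_comp (A : (ℝ × ℝ) ≃L[ℝ] Plane) :
    ∃ c : ℝ≥0∞, c ≠ 0 ∧ c ≠ ⊤ ∧ ∀ g : Plane → ℝ≥0∞, Measurable g →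
      ∫⁻ x, g x = c * ∫⁻ z, g (A z) := by
  have : (Measure.map A (volume : Measure (ℝ × ℝ))).IsAddHaarMeasure :=
    A.isAddHaarMeasure_map _
  have h := Measure.isAddLeftInvariant_eq_smul (volume : Measure Plane)
    (Measure.map A (volume : Measure (ℝ × ℝ)))
  set c : ℝ≥0 := (volume : Measure Plane).addHaarScalarFactor
    (Measure.map A (volume : Measure (ℝ × ℝ)))
  have hc : c ≠ 0 := (Measure.addHaarScalarFactor_pos_of_isAddHaarMeasure _ _).ne'
  refine ⟨c, by simpa using hc, ENNReal.coe_ne_top, fun g hg => ?_⟩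
  conv_lhs => rw [h]
  rw [lintegral_smul_measure, lintegral_map hg A.continuous.measurable]
  rfl

/-- Gagliardo's inequality on sector-stable sets. -/
lemma exists_lintegral_sq_le (A : (ℝ × ℝ) ≃L[ℝ] Plane) :
    ∃ C : ℝ≥0∞, C ≠ ⊤ ∧ ∀ U : Set Plane, MeasurableSet U → IsSectorStable A U →
      ∀ f : Plane → ℝ, ContDiff ℝ 1 f → HasCompactSupport f →
        ∫⁻ x in U, ‖f x‖ₑ ^ 2 ≤ C * (∫⁻ x in U, ‖fderiv ℝ f x‖ₑ) ^ 2 := by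
  obtain ⟨c, hc0, hct, hc⟩ := exists_lintegral_eq_mul_lintegral_comp A
  refine ⟨c⁻¹ * (‖A (1, 0)‖ₑ * ‖A (0, 1)‖ₑ), ?_, fun U hUm hU f hf hfc => ?_⟩
  · exact ENNReal.mul_ne_top (by simpa using hc0) (ENNReal.mul_ne_top (by simp) (by simp))
  set W : Set (ℝ × ℝ) := A ⁻¹' U with hW
  have hWm : MeasurableSet W := A.continuous.measurable hUm
  have hset : ∀ g : Plane → ℝ≥0∞, Measurable g →
      ∫⁻ x in U, g x = c * ∫⁻ z in W, g (A z) := by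
    intro g hg
    rw [← lintegral_indicator hUm, ← lintegral_indicator hWm, hc _ (hg.indicator hUm)]
    rfl
  have hcd : Continuous (fderiv ℝ f) := hf.continuous_fderiv one_ne_zero
  have key := lintegral_sq_le_of_quadrant hWm (f := f ∘ A)
    (fun z hz p q hp hq => by simpa [hW] using hU _ hz p q hp hq)
    (hf.comp A.contDiff) (hfc.comp_homeomorph A.toHomeomorph)
  have hder : ∀ z v, fderiv ℝ (f ∘ A) z v = fderiv ℝ f (A z) (A v) := fun z v => by
    rw [((hf.differentiable one_ne_zero (A z)).hasFDerivAt.comp z A.hasFDerivAt).fderiv]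
    rfl
  have hb : ∀ v, ∫⁻ z in W, ‖fderiv ℝ (f ∘ A) z v‖ₑ ≤
      ‖A v‖ₑ * ∫⁻ z in W, ‖fderiv ℝ f (A z)‖ₑ := by
    intro v
    rw [← lintegral_const_mul' _ _ (by simp)]
    refine lintegral_mono fun z => ?_
    rw [hder, mul_comm]
    exact ContinuousLinearMap.le_opENorm _ _
  rw [hset _ (hf.continuous.measurable.enorm.pow_const 2), hset _ hcd.measurable.enorm]
  set D := ∫⁻ z in W, ‖fderiv ℝ f (A z)‖ₑ
  calc c * ∫⁻ z in W, ‖f (A z)‖ₑ ^ 2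
      ≤ c * ((‖A (1, 0)‖ₑ * D) * (‖A (0, 1)‖ₑ * D)) := by
        gcongr
        exact key.trans (mul_le_mul' (hb _) (hb _))
    _ = c⁻¹ * c * (c * ((‖A (1, 0)‖ₑ * D) * (‖A (0, 1)‖ₑ * D))) := by
        rw [ENNReal.inv_mul_cancel hc0 hct, one_mul]
    _ = _ := by ring

/-- The iteration step from `L^{2k}` to `L^{2(k+1)}`. -/
lemma lintegral_pow_succ_le {C : ℝ≥0∞} {U : Set Plane}
    (hC : ∀ f : Plane → ℝ, ContDiff ℝ 1 f → HasCompactSupport f →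
        ∫⁻ x in U, ‖f x‖ₑ ^ 2 ≤ C * (∫⁻ x in U, ‖fderiv ℝ f x‖ₑ) ^ 2)
    {f : Plane → ℝ} (hf : ContDiff ℝ 1 f) (hfc : HasCompactSupport f) (k : ℕ) :
    ∫⁻ x in U, ‖f x‖ₑ ^ (2 * (k + 1)) ≤
      C * (k + 1) ^ 2 * (∫⁻ x in U, ‖fderiv ℝ f x‖ₑ ^ 2) * ∫⁻ x in U, ‖f x‖ₑ ^ (2 * k) := by
  have hcd : Continuous (fderiv ℝ f) := hf.continuous_fderiv one_ne_zero
  have hder : ∀ x, ‖fderiv ℝ (fun x => f x ^ (k + 1)) x‖ₑ =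
      (k + 1) * (‖fderiv ℝ f x‖ₑ * ‖f x‖ₑ ^ k) := by
    intro x
    rw [((hf.differentiable one_ne_zero x).hasFDerivAt.pow (k + 1)).fderiv, enorm_smul]
    simp only [nsmul_eq_mul, enorm_mul, enorm_pow, Nat.add_sub_cancel]
    rw [Real.enorm_natCast]
    push_cast
    ring
  have h := hC (fun x => f x ^ (k + 1)) (hf.pow _)
    (hfc.comp_left (g := fun t : ℝ => t ^ (k + 1)) (by simp))
  simp only [hder] at h
  rw [lintegral_const_mul' _ _ (by finiteness), mul_pow] at h
  have hcs := sq_lintegral_mul_le (volume.restrict U) hcd.measurable.enorm.aemeasurable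
    (hf.continuous.measurable.enorm.pow_const k).aemeasurable
  calc ∫⁻ x in U, ‖f x‖ₑ ^ (2 * (k + 1)) = ∫⁻ x in U, ‖f x ^ (k + 1)‖ₑ ^ 2 := by
        simp only [enorm_pow, ← pow_mul, mul_comm]
    _ ≤ _ := h
    _ ≤ C * ((k + 1) ^ 2 * ((∫⁻ x in U, ‖fderiv ℝ f x‖ₑ ^ 2) *
          ∫⁻ x in U, (‖f x‖ₑ ^ k) ^ 2)) := by gcongr
    _ = _ := by
        simp only [← pow_mul, mul_comm k 2]
        ring

/-- On a set where Gagliardo's inequality holds, `L²` bounds for a function and its gradient give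
a bound in every `L^{2k}`. -/
lemma exists_lintegral_pow_le {C M : ℝ≥0∞} (hCt : C ≠ ⊤) (hM : M ≠ ⊤) {U : Set Plane}
    (hC : ∀ f : Plane → ℝ, ContDiff ℝ 1 f → HasCompactSupport f →
        ∫⁻ x in U, ‖f x‖ₑ ^ 2 ≤ C * (∫⁻ x in U, ‖fderiv ℝ f x‖ₑ) ^ 2) (k : ℕ) :
    ∃ B : ℝ≥0∞, B ≠ ⊤ ∧ ∀ f : Plane → ℝ, ContDiff ℝ 1 f → HasCompactSupport f →
      ∫⁻ x in U, ‖f x‖ₑ ^ 2 ≤ M → ∫⁻ x in U, ‖fderiv ℝ f x‖ₑ ^ 2 ≤ M →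
        ∫⁻ x in U, ‖f x‖ₑ ^ (2 * (k + 1)) ≤ B := by
  induction k with
  | zero => exact ⟨M, hM, fun f _ _ h _ => by simpa using h⟩
  | succ k ih =>
    obtain ⟨B, hB, h⟩ := ih
    refine ⟨C * ((k + 1 : ℕ) + 1) ^ 2 * M * B, by finiteness, fun f hf hfc h1 h2 => ?_⟩
    refine (lintegral_pow_succ_le hC hf hfc (k + 1)).trans ?_
    gcongr
    exact h f hf hfc h1 h2

/-- Mollifiers supported in the sector `A([0, ∞)²)`, with Lebesgue's differentiation theorem. -/
structure IsSectorMollifier (A : (ℝ × ℝ) ≃L[ℝ] Plane) (ψ : ℕ → Plane → ℝ) : Prop where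
  smooth : ∀ n, ContDiff ℝ ∞ (ψ n)
  hasCompactSupport : ∀ n, HasCompactSupport (ψ n)
  lintegral_enorm : ∀ n, ∫⁻ x, ‖ψ n x‖ₑ = 1
  tsupport_subset : ∀ n, ∀ x ∈ tsupport (ψ n), ∃ p q : ℝ, 0 ≤ p ∧ 0 ≤ q ∧ A (p, q) = x
  tsupport_small : ∀ r : ℝ, 0 < r → ∀ᶠ n in atTop, tsupport (ψ n) ⊆ Metric.ball 0 r
  tendsto : ∀ g : Plane → ℝ, LocallyIntegrable g → ∀ᵐ x,
    Tendsto (fun n => ∫ y, g y * ψ n (x - y)) atTop (𝓝 (g x))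

lemma exists_ball_subset_sector (A : (ℝ × ℝ) ≃L[ℝ] Plane) :
    ∃ δ : ℝ, 0 < δ ∧ ∀ t : ℝ, 0 < t → ∀ x ∈ Metric.closedBall (t • A (1, 1)) (t * δ),
      ∃ p q : ℝ, 0 ≤ p ∧ 0 ≤ q ∧ A (p, q) = x := by
  have ho : IsOpen (A.symm ⁻¹' (Set.Ioi 0 ×ˢ Set.Ioi 0)) :=
    (isOpen_Ioi.prod isOpen_Ioi).preimage A.symm.continuous
  obtain ⟨δ, hδ, h⟩ := Metric.nhds_basis_closedBall.mem_iff.1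
    (ho.mem_nhds (x := A (1, 1)) (by simp))
  refine ⟨δ, hδ, fun t ht x hx => ?_⟩
  have hx' : t⁻¹ • x ∈ Metric.closedBall (A (1, 1)) δ := by
    rw [Metric.mem_closedBall, dist_eq_norm] at hx ⊢
    have : t⁻¹ • x - A (1, 1) = t⁻¹ • (x - t • A (1, 1)) := by
      rw [smul_sub, smul_smul, inv_mul_cancel₀ ht.ne', one_smul]
    rw [this, norm_smul, Real.norm_of_nonneg (inv_nonneg.2 ht.le)]
    calc t⁻¹ * ‖x - t • A (1, 1)‖ ≤ t⁻¹ * (t * δ) := by gcongr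
      _ = δ := by field_simp
  have hm := h hx'
  simp only [Set.mem_preimage, map_smul, Set.mem_prod, Prod.smul_fst, Prod.smul_snd, Set.mem_Ioi,
    smul_eq_mul] at hm
  refine ⟨(A.symm x).1, (A.symm x).2, ?_, ?_, by simp⟩
  · exact (pos_of_mul_pos_right hm.1 (inv_nonneg.2 ht.le)).le
  · exact (pos_of_mul_pos_right hm.2 (inv_nonneg.2 ht.le)).le

lemma exists_isSectorMollifier (A : (ℝ × ℝ) ≃L[ℝ] Plane) :
    ∃ ψ : ℕ → Plane → ℝ, IsSectorMollifier A ψ := by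
  obtain ⟨δ, hδ, hsec⟩ := exists_ball_subset_sector A
  set c : Plane := A (1, 1) with hc
  set t : ℕ → ℝ := fun n => 1 / ((n : ℝ) + 1) with ht
  have htpos : ∀ n, 0 < t n := fun n => by positivity
  have htlim : Tendsto t atTop (𝓝 0) := tendsto_one_div_add_atTop_nhds_zero_nat
  let b : ∀ n, ContDiffBump (t n • c) := fun n =>
    ⟨t n * δ / 2, t n * δ, by have := htpos n; positivity, by
      have := mul_pos (htpos n) hδ; linarith⟩
  refine ⟨fun n => (b n).normed volume, ?_, ?_, ?_, ?_, ?_, ?_⟩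
  · exact fun n => (b n).contDiff_normed
  · exact fun n => (b n).hasCompactSupport_normed
  · intro n
    rw [← ofReal_integral_norm_eq_lintegral_enorm (b n).integrable_normed]
    simp only [Real.norm_of_nonneg ((b n).nonneg_normed _), (b n).integral_normed,
      ENNReal.ofReal_one]
  · intro n x hx
    rw [(b n).tsupport_normed_eq] at hx
    exact hsec (t n) (htpos n) x hx
  · intro r hr
    have hl : Tendsto (fun n => t n * (δ + ‖c‖)) atTop (𝓝 0) := by
      simpa using htlim.mul_const (δ + ‖c‖)
    filter_upwards [hl.eventually_lt_const hr] with n hn x hx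
    rw [(b n).tsupport_normed_eq] at hx
    have hx' : ‖x - t n • c‖ ≤ t n * δ := by simpa [dist_eq_norm] using hx
    rw [mem_ball_zero_iff]
    calc ‖x‖ = ‖(x - t n • c) + t n • c‖ := by simp
      _ ≤ ‖x - t n • c‖ + ‖t n • c‖ := norm_add_le _ _
      _ ≤ t n * δ + t n * ‖c‖ := by
        rw [norm_smul, Real.norm_of_nonneg (htpos n).le]; gcongr
      _ < r := by linarith
  · intro g hg
    filter_upwards [IsUnifLocDoublingMeasure.ae_tendsto_average_norm_sub volume hg (‖c‖ / δ)]
      with x hx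
    have hlim : Tendsto (fun n => t n * δ) atTop (𝓝[>] 0) := by
      refine tendsto_nhdsWithin_iff.2 ⟨by simpa using htlim.mul_const δ, ?_⟩
      exact Eventually.of_forall fun n => mul_pos (htpos n) hδ
    have hav := hx (fun n => x - t n • c) (fun n => t n * δ) hlim (by
      refine Eventually.of_forall fun n => ?_
      rw [Metric.mem_closedBall, dist_eq_norm, sub_sub_cancel, norm_smul,
        Real.norm_of_nonneg (htpos n).le]
      apply le_of_eq
      field_simp)
    have key := tendsto_integral_smul_of_tendsto_average_norm_sub (μ := volume)
      (g := fun n y => (b n).normed volume (x - y)) (2 ^ Module.finrank ℝ Plane) hav ?_ ?_ ?_ ?_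
    · simpa [mul_comm] using key
    · exact Eventually.of_forall fun n => hg.integrableOn_isCompact (isCompact_closedBall _ _)
    · refine tendsto_const_nhds.congr fun n => ?_
      rw [integral_sub_left_eq_self (fun y => (b n).normed volume y) volume x,
        (b n).integral_normed]
    · refine Eventually.of_forall fun n y hy => ?_
      have h : x - y ∈ Function.support ((b n).normed volume) := hy
      rw [(b n).support_normed_eq, Metric.mem_ball, dist_eq_norm] at h
      rw [Metric.mem_closedBall, dist_eq_norm, ← norm_neg]
      refine le_trans (le_of_eq ?_) h.le
      congr 1
      abel
    · refine Eventually.of_forall fun n y => ?_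
      rw [abs_of_nonneg ((b n).nonneg_normed _), Measure.addHaar_real_closedBall_center]
      have := (b n).normed_le_div_measure_closedBall_rOut volume 2
        (by change t n * δ ≤ 2 * (t n * δ / 2); linarith) (x - y)
      rwa [Measure.addHaar_real_closedBall_center] at this

/-- Young's inequality for the convolution of an `L²` function with a probability density. -/
lemma lintegral_sq_lintegral_mul_le {μ : Measure Plane} [SFinite μ] (hμ : μ ≤ volume)
    {h : Plane → ℝ≥0∞} (hh : Measurable h) {ψ : Plane → ℝ} (hψ : Continuous ψ)
    (hψ1 : ∫⁻ x, ‖ψ x‖ₑ = 1) :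
    ∫⁻ x, (∫⁻ y, h y * ‖ψ (x - y)‖ₑ ∂μ) ^ 2 ≤ ∫⁻ y, h y ^ 2 ∂μ := by
  have hm : Measurable fun p : Plane × Plane => ‖ψ (p.1 - p.2)‖ₑ :=
    (hψ.comp (continuous_fst.sub continuous_snd)).measurable.enorm
  have h1 : ∀ x, (∫⁻ y, h y * ‖ψ (x - y)‖ₑ ∂μ) ^ 2 ≤ ∫⁻ y, h y ^ 2 * ‖ψ (x - y)‖ₑ ∂μ := by
    intro x
    have hmx : Measurable fun y => ‖ψ (x - y)‖ₑ := hm.comp measurable_prodMk_left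
    have e : ∀ k : Plane → ℝ≥0∞, Measurable k → ∫⁻ y, k y * ‖ψ (x - y)‖ₑ ∂μ =
        ∫⁻ y, k y ∂(μ.withDensity fun y => ‖ψ (x - y)‖ₑ) := by
      intro k hk
      rw [lintegral_withDensity_eq_lintegral_mul _ hmx hk]
      simp [mul_comm]
    rw [e h hh, e _ (hh.pow_const 2)]
    have hcs := sq_lintegral_mul_le (μ.withDensity fun y => ‖ψ (x - y)‖ₑ) hh.aemeasurable
      (aemeasurable_const (b := (1 : ℝ≥0∞)))
    simp only [mul_one, one_pow, lintegral_const, one_mul] at hcs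
    refine hcs.trans (mul_le_of_le_one_right' ?_)
    rw [withDensity_apply _ MeasurableSet.univ, Measure.restrict_univ]
    calc ∫⁻ y, ‖ψ (x - y)‖ₑ ∂μ ≤ ∫⁻ y, ‖ψ (x - y)‖ₑ := lintegral_mono' hμ le_rfl
      _ = 1 := by rw [lintegral_sub_left_eq_self (fun y => ‖ψ y‖ₑ) x, hψ1]
  calc ∫⁻ x, (∫⁻ y, h y * ‖ψ (x - y)‖ₑ ∂μ) ^ 2
      ≤ ∫⁻ x, ∫⁻ y, h y ^ 2 * ‖ψ (x - y)‖ₑ ∂μ := lintegral_mono h1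
    _ = ∫⁻ y, (∫⁻ x, h y ^ 2 * ‖ψ (x - y)‖ₑ) ∂μ :=
      lintegral_lintegral_swap (f := fun x y => h y ^ 2 * ‖ψ (x - y)‖ₑ) (((hh.comp measurable_snd).pow_const 2).mul hm).aemeasurable
    _ = ∫⁻ y, h y ^ 2 ∂μ := by
      refine lintegral_congr fun y => ?_
      have hmy : Measurable fun x => ‖ψ (x - y)‖ₑ := hm.comp measurable_prodMk_right
      rw [lintegral_const_mul _ hmy,
        lintegral_sub_right_eq_self (fun x => ‖ψ x‖ₑ) y, hψ1, mul_one]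

lemma hasFDerivAt_mollification {g ψ : Plane → ℝ} (hg : LocallyIntegrable g)
    (hψ : ContDiff ℝ ∞ ψ) (hψc : HasCompactSupport ψ) (x : Plane) :
    ∃ D : Plane →L[ℝ] ℝ, HasFDerivAt (fun x => ∫ y, g y * ψ (x - y)) D x ∧
      ∀ v, D v = ∫ y, g y * fderiv ℝ ψ (x - y) v := by
  have hψ1 : ContDiff ℝ 1 ψ := hψ.of_le (by norm_cast)
  refine ⟨_, hψc.hasFDerivAt_convolution_right (ContinuousLinearMap.mul ℝ ℝ) hg hψ1 x,
    fun v => ?_⟩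
  rw [convolution_precompR_apply _ hg (hψc.fderiv ℝ) (hψ1.continuous_fderiv one_ne_zero)]
  rfl

lemma contDiff_mollification {g ψ : Plane → ℝ} (hg : LocallyIntegrable g)
    (hψ : ContDiff ℝ ∞ ψ) (hψc : HasCompactSupport ψ) :
    ContDiff ℝ ∞ (fun x => ∫ y, g y * ψ (x - y)) :=
  hψc.contDiff_convolution_right (ContinuousLinearMap.mul ℝ ℝ) hg hψ

lemma enorm_le_sum_coord (D : Plane →L[ℝ] ℝ) :
    ‖D‖ₑ ≤ ∑ i, ‖D (EuclideanSpace.single i 1)‖ₑ := by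
  have h : ‖D‖ ≤ ∑ i, ‖D (EuclideanSpace.single i 1)‖ := by
    refine D.opNorm_le_bound (Finset.sum_nonneg fun i _ => norm_nonneg _) fun x => ?_
    have hx : x = ∑ i, x i • EuclideanSpace.single i (1 : ℝ) := by
      ext j
      fin_cases j <;> simp
    conv_lhs => rw [hx, map_sum]
    rw [Finset.sum_mul]
    refine (norm_sum_le _ _).trans (Finset.sum_le_sum fun i _ => ?_)
    rw [map_smul, norm_smul, mul_comm]
    gcongr
    exact PiLp.norm_apply_le x i
  have := ENNReal.ofReal_le_ofReal h
  rwa [ENNReal.ofReal_sum_of_nonneg (fun i _ => norm_nonneg _), ofReal_norm,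
    Finset.sum_congr rfl (fun i _ => ofReal_norm _)] at this

/-- Where the mollifier does not see the complement of `Ω`, the gradient of the mollification is
the mollification of the weak gradient. -/
lemma enorm_fderiv_mollification_le {Ω : Set Plane} (hΩ : IsOpen Ω) {u : Plane → ℝ}
    {G : Plane → Plane} (hu : IntegrableOn u Ω) (hG : HasWeakGradient Ω u G) {ψ : Plane → ℝ}
    (hψ : ContDiff ℝ ∞ ψ) (hψc : HasCompactSupport ψ) {x : Plane}
    (hx : ∀ z ∈ tsupport ψ, x - z ∈ Ω) :
    ‖fderiv ℝ (fun x => ∫ y, Ω.indicator u y * ψ (x - y)) x‖ₑ ≤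
      2 * ∫⁻ y in Ω, ‖G y‖ₑ * ‖ψ (x - y)‖ₑ := by
  have hg : LocallyIntegrable (Ω.indicator u) :=
    ((integrable_indicator_iff hΩ.measurableSet).2 hu).locallyIntegrable
  obtain ⟨D, hD, hDv⟩ := hasFDerivAt_mollification hg hψ hψc x
  rw [hD.fderiv]
  have hφ : IsTestFunction Ω (fun y => ψ (x - y)) := by
    refine ⟨hψ.comp (contDiff_const.sub contDiff_id),
      hψc.comp_homeomorph (Homeomorph.subLeft x), fun y hy => ?_⟩
    have hy' : x - y ∈ tsupport ψ :=
      tsupport_comp_subset_preimage ψ (f := fun y => x - y) (by fun_prop) hy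
    simpa using hx _ hy'
  have hi : ∀ i, ‖D (EuclideanSpace.single i 1)‖ₑ ≤ ∫⁻ y in Ω, ‖G y‖ₑ * ‖ψ (x - y)‖ₑ := by
    intro i
    have hp : ∀ y, partialDeriv i (fun y => ψ (x - y)) y =
        - fderiv ℝ ψ (x - y) (EuclideanSpace.single i 1) := by
      intro y
      have h1 : HasFDerivAt (fun y => ψ (x - y))
          ((fderiv ℝ ψ (x - y)).comp (-ContinuousLinearMap.id ℝ Plane)) y :=
        (hψ.differentiable (by simp) (x - y)).hasFDerivAt.comp y
          ((hasFDerivAt_id y).const_sub x)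
      rw [partialDeriv, h1.fderiv]
      simp
    have hw := hG _ hφ i
    simp only [hp, mul_neg, integral_neg, neg_inj] at hw
    have : D (EuclideanSpace.single i 1) = ∫ y in Ω, G y i * ψ (x - y) := by
      rw [hDv, ← hw, ← integral_indicator hΩ.measurableSet]
      congr 1 with y
      by_cases hy : y ∈ Ω <;> simp [hy]
    rw [this]
    refine (enorm_integral_le_lintegral_enorm _).trans (lintegral_mono fun y => ?_)
    rw [enorm_mul]
    gcongr
    exact enorm_le_iff_norm_le.2 (PiLp.norm_apply_le (G y) i)
  calc ‖D‖ₑ ≤ ∑ i, ‖D (EuclideanSpace.single i 1)‖ₑ := enorm_le_sum_coord D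
    _ ≤ ∑ _i : Fin 2, ∫⁻ y in Ω, ‖G y‖ₑ * ‖ψ (x - y)‖ₑ := Finset.sum_le_sum fun i _ => hi i
    _ = _ := by simp

lemma enorm_fderiv_mul_le {f g : Plane → ℝ} {x : Plane} (hf : DifferentiableAt ℝ f x)
    (hg : DifferentiableAt ℝ g x) :
    ‖fderiv ℝ (fun x => f x * g x) x‖ₑ ≤
      ‖f x‖ₑ * ‖fderiv ℝ g x‖ₑ + ‖fderiv ℝ f x‖ₑ * ‖g x‖ₑ := by
  rw [fderiv_fun_mul hf hg]
  refine (enorm_add_le (f x • fderiv ℝ g x) (g x • fderiv ℝ f x)).trans ?_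
  rw [enorm_smul, enorm_smul, mul_comm ‖g x‖ₑ]

lemma ennreal_add_sq_le (a b : ℝ≥0∞) : (a + b) ^ 2 ≤ 2 * (a ^ 2 + b ^ 2) := by
  have := ENNReal.rpow_add_le_mul_rpow_add_rpow a b (p := 2) (by norm_num)
  norm_num at this
  exact this

/-- Local higher integrability of `W^{1,2}` functions near a point where `Ω` is sector-stable. -/
lemma lintegral_pow_lt_top_of_sectorStable {Ω U : Set Plane} (hΩ : IsOpen Ω) (hU : IsOpen U)
    (A : (ℝ × ℝ) ≃L[ℝ] Plane) (hAU : IsSectorStable A U) {x₀ : Plane} {r : ℝ} (hr : 0 < r)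
    (hUΩ : ∀ x ∈ Metric.ball x₀ r, (x ∈ Ω ↔ x ∈ U)) {u : Plane → ℝ} {G : Plane → Plane}
    (hum : Measurable u) (hGm : Measurable G) (hui : IntegrableOn u Ω)
    (hu : ∫⁻ x in Ω, ‖u x‖ₑ ^ 2 ≠ ⊤) (hG : ∫⁻ x in Ω, ‖G x‖ₑ ^ 2 ≠ ⊤)
    (hw : HasWeakGradient Ω u G) (k : ℕ) :
    ∫⁻ x in Ω ∩ Metric.ball x₀ (r / 4), ‖u x‖ₑ ^ (2 * (k + 1)) < ⊤ := by
  obtain ⟨ψ, hψ⟩ := exists_isSectorMollifier A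
  obtain ⟨C, hCt, hC⟩ := exists_lintegral_sq_le A
  let χ : ContDiffBump x₀ := ⟨r / 4, r / 2, by positivity, by linarith⟩
  have hχs : ContDiff ℝ ∞ χ := χ.contDiff
  have hχd : Continuous (fderiv ℝ χ) := hχs.continuous_fderiv (by simp)
  obtain ⟨Q, hQ⟩ := (χ.hasCompactSupport.fderiv ℝ).exists_bound_of_continuous hχd
  have hg : LocallyIntegrable (Ω.indicator u) :=
    ((integrable_indicator_iff hΩ.measurableSet).2 hui).locallyIntegrable
  set v : ℕ → Plane → ℝ := fun n x => ∫ y, Ω.indicator u y * ψ n (x - y) with hv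
  have hvs : ∀ n, ContDiff ℝ ∞ (v n) := fun n =>
    contDiff_mollification hg (hψ.smooth n) (hψ.hasCompactSupport n)
  set V : ℕ → Plane → ℝ≥0∞ := fun n x => ∫⁻ y in Ω, ‖u y‖ₑ * ‖ψ n (x - y)‖ₑ with hV
  set P : ℕ → Plane → ℝ≥0∞ := fun n x => ∫⁻ y in Ω, ‖G y‖ₑ * ‖ψ n (x - y)‖ₑ with hP
  have hvV : ∀ n x, ‖v n x‖ₑ ≤ V n x := by
    intro n x
    refine (enorm_integral_le_lintegral_enorm _).trans ?_
    simp only [hV]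
    rw [← lintegral_indicator hΩ.measurableSet]
    refine lintegral_mono fun y => ?_
    by_cases hy : y ∈ Ω <;> simp [hy, enorm_mul]
  have hVm : ∀ n, Measurable (V n) := fun n =>
    Measurable.lintegral_prod_right' (f := fun p : Plane × Plane => ‖u p.2‖ₑ * ‖ψ n (p.1 - p.2)‖ₑ)
      ((hum.comp measurable_snd).enorm.mul ((hψ.smooth n).continuous.comp
        (continuous_fst.sub continuous_snd)).measurable.enorm)
  have hV2 : ∀ n, ∫⁻ x, V n x ^ 2 ≤ ∫⁻ x in Ω, ‖u x‖ₑ ^ 2 := fun n =>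
    lintegral_sq_lintegral_mul_le Measure.restrict_le_self hum.enorm (hψ.smooth n).continuous
      (hψ.lintegral_enorm n)
  have hP2 : ∀ n, ∫⁻ x, P n x ^ 2 ≤ ∫⁻ x in Ω, ‖G x‖ₑ ^ 2 := fun n =>
    lintegral_sq_lintegral_mul_le Measure.restrict_le_self hGm.enorm (hψ.smooth n).continuous
      (hψ.lintegral_enorm n)
  set f : ℕ → Plane → ℝ := fun n x => χ x * v n x with hf
  have hfs : ∀ n, ContDiff ℝ 1 (f n) := fun n => (hχs.mul (hvs n)).of_le (by norm_cast)
  have hfc : ∀ n, HasCompactSupport (f n) := fun n => χ.hasCompactSupport.mul_right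
  have hχ1 : ∀ x, ‖χ x‖ₑ ≤ 1 := fun x => by
    rw [← ofReal_norm, Real.norm_of_nonneg χ.nonneg]
    exact ENNReal.ofReal_le_one.2 χ.le_one
  set a := ∫⁻ x in Ω, ‖u x‖ₑ ^ 2
  set b := ∫⁻ x in Ω, ‖G x‖ₑ ^ 2
  have hf2 : ∀ n, ∫⁻ x in U, ‖f n x‖ₑ ^ 2 ≤ a := fun n => by
    refine (lintegral_mono' Measure.restrict_le_self fun x => ?_).trans (hV2 n)
    gcongr
    rw [hf, enorm_mul]
    exact (mul_le_of_le_one_left' (hχ1 x)).trans (hvV n x)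
  have hDf : ∀ᶠ n in atTop, ∫⁻ x in U, ‖fderiv ℝ (f n) x‖ₑ ^ 2 ≤
      2 * (4 * b + ENNReal.ofReal Q ^ 2 * a) := by
    filter_upwards [hψ.tsupport_small (r / 2) (by positivity)] with n hn
    have hpt : ∀ x ∈ U, ‖fderiv ℝ (f n) x‖ₑ ^ 2 ≤
        2 * (4 * P n x ^ 2 + ENNReal.ofReal Q ^ 2 * V n x ^ 2) := by
      intro x hx
      have h1 : ‖χ x‖ₑ * ‖fderiv ℝ (v n) x‖ₑ ≤ 2 * P n x := by
        by_cases hxb : x ∈ Metric.ball x₀ (r / 2)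
        · refine (mul_le_of_le_one_left' (hχ1 x)).trans
            (enorm_fderiv_mollification_le hΩ hui hw (hψ.smooth n) (hψ.hasCompactSupport n) ?_)
          intro z hz
          obtain ⟨p, q, hp, hq, rfl⟩ := hψ.tsupport_subset n z hz
          refine (hUΩ _ ?_).2 (hAU x hx p q hp hq)
          have hz' := hn hz
          rw [mem_ball_zero_iff] at hz'
          rw [Metric.mem_ball, dist_eq_norm] at hxb ⊢
          calc ‖x - A (p, q) - x₀‖ = ‖(x - x₀) - A (p, q)‖ := by congr 1; abel
            _ ≤ ‖x - x₀‖ + ‖A (p, q)‖ := norm_sub_le _ _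
            _ < r := by linarith
        · have : χ x = 0 := by
            rw [← Function.notMem_support, χ.support_eq]
            exact hxb
          simp [this]
      have h2 : ‖fderiv ℝ χ x‖ₑ * ‖v n x‖ₑ ≤ ENNReal.ofReal Q * V n x := by
        refine mul_le_mul' ?_ (hvV n x)
        rw [← ofReal_norm]
        exact ENNReal.ofReal_le_ofReal (hQ x)
      calc ‖fderiv ℝ (f n) x‖ₑ ^ 2 ≤ (2 * P n x + ENNReal.ofReal Q * V n x) ^ 2 := by
            gcongr
            exact (enorm_fderiv_mul_le (hχs.differentiable (by simp) x)
              ((hvs n).differentiable (by simp) x)).trans (add_le_add h1 h2)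
        _ ≤ _ := ennreal_add_sq_le _ _
        _ = _ := by rw [mul_pow, mul_pow]; norm_num
    calc ∫⁻ x in U, ‖fderiv ℝ (f n) x‖ₑ ^ 2
        ≤ ∫⁻ x in U, 2 * (4 * P n x ^ 2 + ENNReal.ofReal Q ^ 2 * V n x ^ 2) :=
          setLIntegral_mono' hU.measurableSet hpt
      _ ≤ ∫⁻ x, 2 * (4 * P n x ^ 2 + ENNReal.ofReal Q ^ 2 * V n x ^ 2) :=
          lintegral_mono' Measure.restrict_le_self le_rfl
      _ = 2 * (4 * (∫⁻ x, P n x ^ 2) + ENNReal.ofReal Q ^ 2 * ∫⁻ x, V n x ^ 2) := by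
          rw [lintegral_const_mul' _ _ (by simp),
            lintegral_add_right _ (((hVm n).pow_const 2).const_mul _),
            lintegral_const_mul' _ _ (by simp), lintegral_const_mul' _ _ (by finiteness)]
      _ ≤ _ := by
          gcongr
          · exact hP2 n
          · exact hV2 n
  obtain ⟨B, hB, hBound⟩ := exists_lintegral_pow_le (M := a + 2 * (4 * b + ENNReal.ofReal Q ^ 2 * a))
    hCt (by finiteness) (hC U hU.measurableSet hAU) k
  have hfb : ∀ᶠ n in atTop, ∫⁻ x in Ω ∩ Metric.ball x₀ (r / 4), ‖f n x‖ₑ ^ (2 * (k + 1)) ≤ B := by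
    filter_upwards [hDf] with n hn
    refine (lintegral_mono_set fun x hx => ?_).trans (hBound (f n) (hfs n) (hfc n)
      ((hf2 n).trans le_self_add) (hn.trans le_add_self))
    exact (hUΩ x (Metric.ball_subset_ball (by linarith) hx.2)).1 hx.1
  have hlim : ∀ᵐ x ∂volume.restrict (Ω ∩ Metric.ball x₀ (r / 4)),
      Tendsto (fun n => ‖f n x‖ₑ ^ (2 * (k + 1))) atTop (𝓝 (‖u x‖ₑ ^ (2 * (k + 1)))) := by
    filter_upwards [ae_restrict_of_ae (hψ.tendsto _ hg),
      ae_restrict_mem (hΩ.measurableSet.inter measurableSet_ball)] with x hx hxm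
    rw [Set.indicator_of_mem hxm.1] at hx
    have h1 : χ x = 1 := χ.one_of_mem_closedBall (Metric.ball_subset_closedBall hxm.2)
    simp only [hf, h1, one_mul]
    exact ((ENNReal.continuous_pow _).tendsto _).comp hx.enorm
  calc ∫⁻ x in Ω ∩ Metric.ball x₀ (r / 4), ‖u x‖ₑ ^ (2 * (k + 1))
      = ∫⁻ x in Ω ∩ Metric.ball x₀ (r / 4),
          liminf (fun n => ‖f n x‖ₑ ^ (2 * (k + 1))) atTop := by
        refine lintegral_congr_ae ?_
        filter_upwards [hlim] with x hx using hx.liminf_eq.symm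
    _ ≤ liminf (fun n => ∫⁻ x in Ω ∩ Metric.ball x₀ (r / 4), ‖f n x‖ₑ ^ (2 * (k + 1))) atTop :=
        lintegral_liminf_le fun n => ((hfs n).continuous.measurable.enorm).pow_const _
    _ ≤ B := liminf_le_of_frequently_le' hfb.frequently
    _ < ⊤ := hB.lt_top

/-- Every point of the closure of a Lipschitz domain has a neighbourhood in which the domain
coincides with an open sector-stable set. -/
lemma IsLipschitzDomain.exists_sectorStable {Ω : Set Plane} (hΩ : IsLipschitzDomain Ω)
    {x₀ : Plane} (hx₀ : x₀ ∈ closure Ω) :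
    ∃ r : ℝ, 0 < r ∧ ∃ (A : (ℝ × ℝ) ≃L[ℝ] Plane) (U : Set Plane), IsOpen U ∧
      IsSectorStable A U ∧ ∀ x ∈ Metric.ball x₀ r, (x ∈ Ω ↔ x ∈ U) := by
  by_cases hx : x₀ ∈ Ω
  · obtain ⟨r, hr, h⟩ := Metric.isOpen_iff.1 hΩ.isOpen x₀ hx
    have A : (ℝ × ℝ) ≃L[ℝ] Plane := ContinuousLinearEquiv.ofFinrankEq (by simp)
    exact ⟨r, hr, A, Set.univ, isOpen_univ, fun _ _ _ _ _ _ => trivial,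
      fun x hx => iff_of_true (h hx) trivial⟩
  · obtain ⟨r, hr, e, γ, L, hγ, h⟩ := hΩ.locally_graph x₀
      ⟨hx₀, fun h => hx (interior_subset h)⟩
    set M : ℝ := L + 1 with hM
    have hMpos : 0 < M := by positivity
    let B₀ : (ℝ × ℝ) →ₗ[ℝ] Plane :=
      { toFun := fun z => !₂[z.2 - z.1, -(M * (z.1 + z.2))]
        map_add' := fun z w => by
          ext i; fin_cases i <;> simp <;> ring
        map_smul' := fun t z => by
          ext i; fin_cases i <;> simp <;> ring }
    have hB₀ : Function.Injective B₀ := by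
      rw [injective_iff_map_eq_zero]
      intro z hz
      have h0 : z.2 - z.1 = 0 := by simpa [B₀] using congrArg (fun w : Plane => w 0) hz
      have h1 : z.1 + z.2 = 0 := by
        simpa [B₀, hMpos.ne'] using congrArg (fun w : Plane => w 1) hz
      ext
      · simp; linarith
      · simp; linarith
    let A : (ℝ × ℝ) ≃L[ℝ] Plane :=
      (LinearEquiv.ofInjectiveOfFinrankEq B₀ hB₀ (by simp)).toContinuousLinearEquiv.trans
        e.symm.toContinuousLinearEquiv
    have hA : ∀ p q, e (A (p, q)) = !₂[q - p, -(M * (p + q))] := fun p q => by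
      change e (e.symm (B₀ (p, q))) = _
      rw [e.apply_symm_apply]
      rfl
    refine ⟨r, hr, A, {x | γ (e x 0) < e x 1}, ?_, ?_, h⟩
    · exact isOpen_lt (hγ.continuous.comp (by fun_prop)) (by fun_prop)
    · intro x hx p q hp hq
      simp only [Set.mem_ofPred_eq, map_sub, hA] at hx ⊢
      have hl := hγ.dist_le_mul (e x 0 - (q - p)) (e x 0)
      rw [Real.dist_eq, Real.dist_eq, sub_sub_cancel_left, abs_neg] at hl
      have h1 : |q - p| ≤ p + q := abs_le.2 ⟨by linarith, by linarith⟩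
      have h2 : (L : ℝ) * |q - p| ≤ L * (p + q) := mul_le_mul_of_nonneg_left h1 L.2
      have h3 := (abs_le.1 hl).2
      have : γ (e x 0 - (q - p)) < e x 1 + M * (p + q) := by rw [hM]; nlinarith
      simpa using this

/-- The Sobolev embedding `W^{1,2}(Ω) ⊆ L^p(Ω)`, `p < ∞`, in the plane. -/
lemma W12.memLp {Ω : Set Plane} (hΩ : IsLipschitzDomain Ω) (hb : Bornology.IsBounded Ω)
    (w : W12 Ω) {p : ℝ≥0∞} (hp : p ≠ ⊤) : MemLp (W12.fn w) p (volume.restrict Ω) := by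
  have : IsFiniteMeasure (volume.restrict Ω) := isFiniteMeasure_restrict.2 hb.measure_lt_top.ne
  obtain ⟨k, hk⟩ := ENNReal.exists_nat_gt hp
  have hm : StronglyMeasurable (W12.fn w) := Lp.stronglyMeasurable w.1.fst
  have hGm : StronglyMeasurable (W12.grad w) := Lp.stronglyMeasurable w.1.snd
  have hu2 : MemLp (W12.fn w) 2 (volume.restrict Ω) := Lp.memLp w.1.fst
  have hG2 : MemLp (W12.grad w) 2 (volume.restrict Ω) := Lp.memLp w.1.snd
  have hfin : ∫⁻ x in Ω, ‖W12.fn w x‖ₑ ^ (2 * (k + 1)) < ⊤ := by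
    have hloc : ∀ x₀ ∈ closure Ω, ∃ t ∈ 𝓝 x₀,
        ∫⁻ x in Ω ∩ t, ‖W12.fn w x‖ₑ ^ (2 * (k + 1)) < ⊤ := by
      intro x₀ hx₀
      obtain ⟨r, hr, A, U, hU, hAU, h⟩ := hΩ.exists_sectorStable hx₀
      refine ⟨Metric.ball x₀ (r / 4), Metric.ball_mem_nhds _ (by positivity), ?_⟩
      refine lintegral_pow_lt_top_of_sectorStable hΩ.isOpen hU A hAU hr h hm.measurable
        hGm.measurable (hu2.integrable (by norm_num)) ?_ ?_ w.2 k
      · simpa using (lintegral_rpow_enorm_lt_top_of_eLpNorm_lt_top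
          (by norm_num) (by norm_num) hu2.eLpNorm_lt_top).ne
      · simpa using (lintegral_rpow_enorm_lt_top_of_eLpNorm_lt_top
          (by norm_num) (by norm_num) hG2.eLpNorm_lt_top).ne
    have hK : IsCompact (closure Ω) := hb.isCompact_closure
    have := hK.induction_on (p := fun t => ∫⁻ x in Ω ∩ t, ‖W12.fn w x‖ₑ ^ (2 * (k + 1)) < ⊤)
      (by simp) (fun s t hst ht => (lintegral_mono_set (Set.inter_subset_inter_right _ hst)).trans_lt
        ht) (fun s t hs ht => by
          rw [Set.inter_union_distrib_left]
          exact (lintegral_union_le _ _ _).trans_lt (ENNReal.add_lt_top.2 ⟨hs, ht⟩))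
      (fun x hx => by
        obtain ⟨t, ht, h⟩ := hloc x hx
        exact ⟨t, mem_nhdsWithin_of_mem_nhds ht, h⟩)
    rwa [Set.inter_eq_left.2 subset_closure] at this
  have hbig : MemLp (W12.fn w) ((2 * (k + 1) : ℕ) : ℝ≥0∞) (volume.restrict Ω) := by
    refine ⟨hm.aestronglyMeasurable, ?_⟩
    rw [eLpNorm_lt_top_iff_lintegral_rpow_enorm_lt_top (by simp) (ENNReal.natCast_ne_top _),
      ENNReal.toReal_natCast]
    simpa only [ENNReal.rpow_natCast] using hfin
  refine hbig.mono_exponent (hk.le.trans ?_)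
  exact_mod_cast (by omega : k ≤ 2 * (k + 1))

section AbstractMinimization

lemma rpow_add_add_rpow_le {s R B d : ℝ} (hs : 1 ≤ s) (hR : 0 ≤ R) (hRB : R ≤ B) (hd : 0 ≤ d) :
    (R + d) ^ s + B ^ s ≤ R ^ s + (B + d) ^ s := by
  rcases hRB.eq_or_lt with rfl | hlt
  · exact (add_comm _ _).le
  have hc := convexOn_rpow hs
  have hpos : 0 < B + d - R := by linarith
  have hx : R ∈ Set.Ici (0 : ℝ) := hR
  have hy : B + d ∈ Set.Ici (0 : ℝ) := by simp only [Set.mem_Ici]; linarith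
  set l := d / (B + d - R)
  set m := (B - R) / (B + d - R)
  have hl : 0 ≤ l := by positivity
  have hm : 0 ≤ m := div_nonneg (by linarith) hpos.le
  have hlm : l + m = 1 := by simp only [l, m]; field_simp; ring
  have h1 := hc.2 hx hy hm hl (by linarith)
  have h2 := hc.2 hx hy hl hm hlm
  simp only [smul_eq_mul] at h1 h2
  have e1 : m * R + l * (B + d) = R + d := by simp only [l, m]; field_simp; ring
  have e2 : l * R + m * (B + d) = B := by simp only [l, m]; field_simp; ring
  rw [e1] at h1
  rw [e2] at h2
  calc (R + d) ^ s + B ^ s ≤ (l + m) * R ^ s + (l + m) * (B + d) ^ s := by linarith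
    _ = _ := by rw [hlm, one_mul, one_mul]

lemma norm_midpoint_rpow_le {E : Type*} [NormedAddCommGroup E] [NormedSpace ℝ E] {s : ℝ}
    (hs : 1 ≤ s) (a b : E) :
    ‖(1 / 2 : ℝ) • (a + b)‖ ^ s ≤ 1 / 2 * ‖a‖ ^ s + 1 / 2 * ‖b‖ ^ s := by
  have h := (convexOn_rpow hs).2 (show ‖a‖ ∈ Set.Ici 0 from norm_nonneg a)
    (show ‖b‖ ∈ Set.Ici 0 from norm_nonneg b) (show (0 : ℝ) ≤ 1 / 2 by norm_num)
    (show (0 : ℝ) ≤ 1 / 2 by norm_num) (by norm_num)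
  simp only [smul_eq_mul] at h
  refine (Real.rpow_le_rpow (norm_nonneg _) ?_ (by linarith)).trans h
  rw [norm_smul, Real.norm_of_nonneg (by norm_num)]
  linarith [norm_add_le a b]

variable {X H E F : Type*} [NormedAddCommGroup X] [NormedSpace ℝ X] [NormedAddCommGroup H]
  [NormedSpace ℝ H] [NormedAddCommGroup E] [NormedSpace ℝ E]
  [NormedAddCommGroup F] [InnerProductSpace ℝ F]

/-- The functional `‖D v‖² + lam ‖T v - S w‖ ^ s`. -/
noncomputable def fidelityFunctional (D : H →L[ℝ] F) (T : H →L[ℝ] E) (S : X →L[ℝ] E) (lam s : ℝ) (w : X)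
    (v : H) : ℝ :=
  ‖D v‖ ^ 2 + lam * ‖T v - S w‖ ^ s

variable {D : H →L[ℝ] F} {T : H →L[ℝ] E} {S : X →L[ℝ] E} {lam s : ℝ}

lemma fidelityFunctional_nonneg (hlam : 0 ≤ lam) (w : X) (v : H) :
    0 ≤ fidelityFunctional D T S lam s w v := by
  unfold fidelityFunctional
  positivity

lemma fidelityFunctional_midpoint (hlam : 0 ≤ lam) (hs : 1 ≤ s) (w : X) (u v : H) :
    fidelityFunctional D T S lam s w ((1 / 2 : ℝ) • (u + v)) + 1 / 4 * ‖D (u - v)‖ ^ 2 ≤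
      1 / 2 * fidelityFunctional D T S lam s w u + 1 / 2 * fidelityFunctional D T S lam s w v := by
  have h1 := parallelogram_law_with_norm ℝ (D u) (D v)
  have h2 := norm_midpoint_rpow_le hs (T u - S w) (T v - S w)
  have e : T ((1 / 2 : ℝ) • (u + v)) - S w = (1 / 2 : ℝ) • ((T u - S w) + (T v - S w)) := by
    rw [map_smul, map_add]
    module
  have e2 : ‖D ((1 / 2 : ℝ) • (u + v))‖ = 1 / 2 * ‖D u + D v‖ := by
    rw [map_smul, map_add, norm_smul, Real.norm_of_nonneg (by norm_num)]
  unfold fidelityFunctional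
  rw [e, e2, map_sub]
  nlinarith [mul_le_mul_of_nonneg_left h2 hlam]

lemma continuous_fidelityFunctional (hs : 0 ≤ s) (w : X) :
    Continuous (fidelityFunctional D T S lam s w) := by
  unfold fidelityFunctional
  exact (D.continuous.norm.pow 2).add
    (continuous_const.mul ((T.continuous.sub continuous_const).norm.rpow_const fun _ => .inr hs))

lemma continuous_fidelityFunctional_datum (hs : 0 ≤ s) (v : H) :
    Continuous fun w => fidelityFunctional D T S lam s w v := by
  unfold fidelityFunctional
  exact continuous_const.add
    (continuous_const.mul ((continuous_const.sub S.continuous).norm.rpow_const fun _ => .inr hs))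

lemma norm_sub_sq_le_of_forall_le (hlam : 0 ≤ lam) (hs : 1 ≤ s) {w : X} {m : ℝ}
    (hm : ∀ v, m ≤ fidelityFunctional D T S lam s w v) (u v : H) :
    ‖D (u - v)‖ ^ 2 ≤ 2 * (fidelityFunctional D T S lam s w u - m) +
      2 * (fidelityFunctional D T S lam s w v - m) := by
  have h := fidelityFunctional_midpoint (D := D) (T := T) (S := S) hlam hs w u v
  have := hm ((1 / 2 : ℝ) • (u + v))
  linarith

lemma exists_minimizer [CompleteSpace H] (hlam : 0 ≤ lam) (hs : 1 ≤ s) {c : ℝ}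
    (hc : ∀ v, ‖v‖ ^ 2 ≤ c * ‖D v‖ ^ 2) (hc0 : 0 ≤ c) (w : X) :
    ∃ u, ∀ v, fidelityFunctional D T S lam s w u ≤ fidelityFunctional D T S lam s w v := by
  set Φ := fidelityFunctional D T S lam s w with hΦ
  have hbdd : BddBelow (Set.range Φ) :=
    ⟨0, by rintro _ ⟨v, rfl⟩; exact fidelityFunctional_nonneg hlam w v⟩
  set m := ⨅ v, Φ v
  have hm : ∀ v, m ≤ Φ v := fun v => ciInf_le hbdd v
  have hex : ∀ n : ℕ, ∃ v, Φ v < m + 1 / ((n : ℝ) + 1) := fun n =>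
    exists_lt_of_ciInf_lt (lt_add_of_pos_right _ (by positivity))
  choose u hu using hex
  have hlim : Tendsto (fun n : ℕ => 1 / ((n : ℝ) + 1)) atTop (𝓝 0) :=
    tendsto_one_div_add_atTop_nhds_zero_nat
  have hcau : CauchySeq u := by
    refine cauchySeq_of_le_tendsto_0 (fun n : ℕ => √(c * (4 * (1 / ((n : ℝ) + 1))))) ?_ ?_
    · intro n k N hn hk
      rw [dist_eq_norm]
      refine Real.le_sqrt_of_sq_le ((hc _).trans (mul_le_mul_of_nonneg_left ?_ hc0))
      have h := norm_sub_sq_le_of_forall_le hlam hs hm (u n) (u k)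
      have h1 : 1 / ((n : ℝ) + 1) ≤ 1 / ((N : ℝ) + 1) := by gcongr
      have h2 : 1 / ((k : ℝ) + 1) ≤ 1 / ((N : ℝ) + 1) := by gcongr
      have := hu n
      have := hu k
      linarith
    · simpa using ((hlim.const_mul 4).const_mul c).sqrt
  obtain ⟨x, hx⟩ := cauchySeq_tendsto_of_complete hcau
  refine ⟨x, fun v => le_trans ?_ (hm v)⟩
  have h1 : Tendsto (fun n => Φ (u n)) atTop (𝓝 (Φ x)) :=
    ((continuous_fidelityFunctional (by linarith) w).tendsto x).comp hx
  have h2 : Tendsto (fun n : ℕ => m + 1 / ((n : ℝ) + 1)) atTop (𝓝 m) := by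
    simpa using hlim.const_add m
  exact le_of_tendsto_of_tendsto' h1 h2 fun n => (hu n).le

/-- Existence, uniqueness and continuous dependence on the datum of the minimizer. -/
lemma exists_continuous_minimizer [CompleteSpace H] (hlam : 0 < lam) (hs : 1 ≤ s) {c : ℝ}
    (hc : ∀ v, ‖v‖ ^ 2 ≤ c * ‖D v‖ ^ 2) (hc0 : 0 ≤ c) :
    ∃ I : X → H, (∀ w u, (∀ v, fidelityFunctional D T S lam s w u ≤
      fidelityFunctional D T S lam s w v) ↔ u = I w) ∧ Continuous I := by
  have hs0 : 0 < s := by linarith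
  choose I hI using exists_minimizer (D := D) (T := T) (S := S) hlam.le hs hc hc0
  have hstab : ∀ w v, ‖v - I w‖ ^ 2 ≤ c * (2 * (fidelityFunctional D T S lam s w v -
      fidelityFunctional D T S lam s w (I w))) := by
    intro w v
    refine (hc _).trans (mul_le_mul_of_nonneg_left ?_ hc0)
    have := norm_sub_sq_le_of_forall_le hlam.le hs (hI w) v (I w)
    linarith
  refine ⟨I, fun w u => ⟨fun h => ?_, fun h => h ▸ hI w⟩, ?_⟩
  · have h1 := hstab w u
    rw [le_antisymm (h (I w)) (hI w u), sub_self, mul_zero, mul_zero] at h1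
    exact sub_eq_zero.1 (norm_eq_zero.1 (pow_eq_zero_iff two_ne_zero |>.1
      (le_antisymm h1 (sq_nonneg _))))
  · rw [continuous_iff_continuousAt]
    intro w₀
    have hbd : ∀ w, ‖T (I w) - S w‖ ≤ ‖S w‖ := by
      intro w
      have h := hI w 0
      unfold fidelityFunctional at h
      simp only [map_zero, norm_zero, zero_sub, norm_neg] at h
      have h' : lam * ‖T (I w) - S w‖ ^ s ≤ lam * ‖S w‖ ^ s := by
        nlinarith [sq_nonneg ‖D (I w)‖]
      exact (Real.rpow_le_rpow_iff (norm_nonneg _) (norm_nonneg _) hs0).1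
        (le_of_mul_le_mul_left h' hlam)
    set ρ : X → ℝ := fun w => lam * ((‖S w‖ + ‖S w - S w₀‖) ^ s - ‖S w‖ ^ s) +
      (fidelityFunctional D T S lam s w (I w₀) - fidelityFunctional D T S lam s w₀ (I w₀)) with hρ
    have hle : ∀ w, fidelityFunctional D T S lam s w₀ (I w) -
        fidelityFunctional D T S lam s w₀ (I w₀) ≤ ρ w := by
      intro w
      have h1 := hI w (I w₀)
      have h2 : fidelityFunctional D T S lam s w₀ (I w) - fidelityFunctional D T S lam s w (I w) ≤
          lam * ((‖S w‖ + ‖S w - S w₀‖) ^ s - ‖S w‖ ^ s) := by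
        have e : T (I w) - S w₀ = (T (I w) - S w) + (S w - S w₀) := by abel
        have h3 : ‖T (I w) - S w₀‖ ^ s ≤ (‖T (I w) - S w‖ + ‖S w - S w₀‖) ^ s := by
          rw [e]
          exact Real.rpow_le_rpow (norm_nonneg _) (norm_add_le _ _) hs0.le
        have h4 := rpow_add_add_rpow_le hs (norm_nonneg (T (I w) - S w)) (hbd w)
          (norm_nonneg (S w - S w₀))
        unfold fidelityFunctional
        have h5 : ‖T (I w) - S w₀‖ ^ s - ‖T (I w) - S w‖ ^ s ≤
          (‖S w‖ + ‖S w - S w₀‖) ^ s - ‖S w‖ ^ s := by linarith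
        linarith [mul_le_mul_of_nonneg_left h5 hlam.le]
      rw [hρ]
      linarith
    have hρc : Continuous ρ := by
      refine (continuous_const.mul (Continuous.sub ?_ ?_)).add
        ((continuous_fidelityFunctional_datum hs0.le _).sub continuous_const)
      · exact (S.continuous.norm.add (S.continuous.sub continuous_const).norm).rpow_const
          fun _ => .inr hs0.le
      · exact S.continuous.norm.rpow_const fun _ => .inr hs0.le
    have hρ0 : ρ w₀ = 0 := by simp [hρ]
    have hlim : Tendsto (fun w => √(c * (2 * ρ w))) (𝓝 w₀) (𝓝 0) := by
      have : Continuous fun w => √(c * (2 * ρ w)) := by fun_prop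
      simpa [hρ0] using this.tendsto w₀
    refine tendsto_iff_norm_sub_tendsto_zero.2 (squeeze_zero (fun _ => norm_nonneg _)
      (fun w => Real.le_sqrt_of_sq_le ((hstab w₀ (I w)).trans ?_)) hlim)
    exact mul_le_mul_of_nonneg_left (mul_le_mul_of_nonneg_left (hle w) zero_le_two) hc0

lemma exists_continuous_minimizer_submodule (M : Submodule ℝ X) [CompleteSpace M] (D : X →L[ℝ] F)
    (S : X →L[ℝ] E) (hlam : 0 < lam) (hs : 1 ≤ s) {c : ℝ}
    (hc : ∀ v : M, ‖v‖ ^ 2 ≤ c * ‖D v‖ ^ 2) (hc0 : 0 ≤ c) :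
    ∃ I : X → M, (∀ (w : X) (u : M), (∀ v : M, ‖D u‖ ^ 2 + lam * ‖S u - S w‖ ^ s ≤
      ‖D v‖ ^ 2 + lam * ‖S v - S w‖ ^ s) ↔ u = I w) ∧ Continuous I :=
  exists_continuous_minimizer (D := D.comp M.subtypeL) (T := S.comp M.subtypeL) (S := S) hlam hs
    hc hc0

end AbstractMinimization

lemma isClosed_W12 (Ω : Set Plane) : IsClosed (W12 Ω : Set (L2Pair Ω)) := by
  have h1 : ∀ (φ : Plane → ℝ) (hφ : IsTestFunction Ω φ) (i : Fin 2),
      Continuous fun p : L2Pair Ω => ∫ x in Ω, p.fst x * partialDeriv i φ x := by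
    intro φ hφ i
    have : Continuous fun p : L2Pair Ω => inner ℝ (hφ.memLp_partialDeriv i).toLp p.fst :=
      continuous_const.inner (WithLp.continuous_fst 2 _ _)
    refine this.congr fun p => ?_
    rw [L2.inner_def]
    refine integral_congr_ae ?_
    filter_upwards [(hφ.memLp_partialDeriv i).coeFn_toLp] with x hx
    rw [hx]
    simp
  have h2 : ∀ (φ : Plane → ℝ) (hφ : IsTestFunction Ω φ) (i : Fin 2),
      Continuous fun p : L2Pair Ω => ∫ x in Ω, p.snd x i * φ x := by
    intro φ hφ i
    have hm : MemLp (fun x => φ x • EuclideanSpace.single i (1 : ℝ)) 2 (volume.restrict Ω) :=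
      (ContinuousLinearMap.toSpanSingleton ℝ (EuclideanSpace.single i (1 : ℝ))).comp_memLp'
        hφ.memLp
    have : Continuous fun p : L2Pair Ω => inner ℝ hm.toLp p.snd :=
      continuous_const.inner (WithLp.continuous_snd 2 _ _)
    refine this.congr fun p => ?_
    rw [L2.inner_def]
    refine integral_congr_ae ?_
    filter_upwards [hm.coeFn_toLp] with x hx
    rw [hx, real_inner_smul_left, EuclideanSpace.inner_single_left]
    simp [mul_comm]
  have : (W12 Ω : Set (L2Pair Ω)) = ⋂ (φ : Plane → ℝ) (_ : IsTestFunction Ω φ) (i : Fin 2),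
      {p : L2Pair Ω | ∫ x in Ω, p.fst x * partialDeriv i φ x = -∫ x in Ω, p.snd x i * φ x} := by
    ext p
    simp only [Set.mem_iInter]
    rfl
  rw [this]
  exact isClosed_iInter fun φ => isClosed_iInter fun hφ => isClosed_iInter fun i =>
    isClosed_eq (h1 φ hφ i) (h2 φ hφ i).neg

instance (Ω : Set Plane) : CompleteSpace (W12 Ω) := (isClosed_W12 Ω).completeSpace_coe

instance (Ω : Set Plane) : CompleteSpace (W012 Ω) :=
  (Submodule.isClosed_topologicalClosure _).completeSpace_coe

/-- The weak gradient as a bounded operator. -/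
noncomputable def W12.gradL (Ω : Set Plane) : W12 Ω →L[ℝ] Lp Plane 2 (volume.restrict Ω) :=
  (WithLp.sndL 2 ℝ _ _).comp (W12 Ω).subtypeL

lemma W12.norm_sq_eq {Ω : Set Plane} (u : W12 Ω) :
    ‖u‖ ^ 2 = ‖u.1.fst‖ ^ 2 + ‖W12.gradL Ω u‖ ^ 2 :=
  WithLp.prod_norm_sq_eq_of_L2 u.1

lemma ofReal_norm_sq_Lp {α E : Type*} [MeasurableSpace α] {μ : Measure α} [NormedAddCommGroup E]
    (f : Lp E 2 μ) : ENNReal.ofReal (‖f‖ ^ 2) = ∫⁻ x, ‖f x‖ₑ ^ 2 ∂μ := by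
  rw [ENNReal.ofReal_pow (norm_nonneg _), ofReal_norm, Lp.enorm_def,
    eLpNorm_eq_lintegral_rpow_enorm_toReal two_ne_zero (by simp), ← ENNReal.rpow_natCast,
    ← ENNReal.rpow_mul]
  simp

/-- A test function, together with its classical gradient, is an element of `W^{1,2}(Ω)`. -/
lemma IsTestFunction.exists_W12 {Ω : Set Plane} {φ : Plane → ℝ} (hφ : IsTestFunction Ω φ) :
    ∃ u : W12 Ω, W12.fn u =ᵐ[volume.restrict Ω] φ ∧
      W12.grad u =ᵐ[volume.restrict Ω] fun x => WithLp.toLp 2 fun i => partialDeriv i φ x := by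
  have hpc : ∀ i, Continuous (partialDeriv i φ) := fun i =>
    (hφ.smooth.continuous_fderiv (by simp)).clm_apply continuous_const
  have hps : ∀ i, HasCompactSupport (partialDeriv i φ) := fun i =>
    hφ.hasCompactSupport.fderiv_apply (𝕜 := ℝ) _
  have hG : MemLp (fun x => (WithLp.toLp 2 fun i => partialDeriv i φ x : Plane)) 2
      (volume.restrict Ω) := by
    refine (Continuous.memLp_of_hasCompactSupport ?_ ?_).restrict Ω
    · exact (PiLp.continuous_toLp 2 _).comp (continuous_pi hpc)
    · refine (hφ.hasCompactSupport.fderiv ℝ).mono fun x hx => ?_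
      contrapose! hx
      rw [Function.notMem_support] at hx ⊢
      ext i
      simp [partialDeriv, hx]
  have hmem : (WithLp.toLp 2 (hφ.memLp.toLp, hG.toLp) : L2Pair Ω) ∈ W12 Ω := by
    intro η hη i
    have e1 : ∫ x in Ω, hφ.memLp.toLp φ x * partialDeriv i η x = ∫ x, φ x * partialDeriv i η x := by
      refine Eq.trans ?_ (setIntegral_eq_integral_of_forall_compl_eq_zero (s := Ω) ?_)
      · refine integral_congr_ae ?_
        filter_upwards [hφ.memLp.coeFn_toLp] with x hx
        rw [hx]
      · intro x hx
        rw [image_eq_zero_of_notMem_tsupport fun h => hx (hφ.tsupport_subset h), zero_mul]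
    have e2 : ∫ x in Ω, hG.toLp _ x i * η x = ∫ x, partialDeriv i φ x * η x := by
      refine Eq.trans ?_ (setIntegral_eq_integral_of_forall_compl_eq_zero (s := Ω) ?_)
      · refine integral_congr_ae ?_
        filter_upwards [hG.coeFn_toLp] with x hx
        rw [hx]
      · intro x hx
        rw [image_eq_zero_of_notMem_tsupport fun h => hx (hη.tsupport_subset h), mul_zero]
    change ∫ x in Ω, hφ.memLp.toLp φ x * partialDeriv i η x = -∫ x in Ω, hG.toLp _ x i * η x
    rw [e1, e2]
    have hηc : Continuous (partialDeriv i η) :=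
      (hη.smooth.continuous_fderiv (by simp)).clm_apply continuous_const
    exact integral_mul_fderiv_eq_neg_fderiv_mul_of_integrable
      (((hpc i).mul hη.smooth.continuous).integrable_of_hasCompactSupport (hps i).mul_right)
      ((hφ.smooth.continuous.mul hηc).integrable_of_hasCompactSupport
        hφ.hasCompactSupport.mul_right)
      ((hφ.smooth.continuous.mul hη.smooth.continuous).integrable_of_hasCompactSupport
        hφ.hasCompactSupport.mul_right)
      (fun x _ => hφ.smooth.differentiable (by simp) x)
      (fun x _ => hη.smooth.differentiable (by simp) x)
  exact ⟨⟨_, hmem⟩, hφ.memLp.coeFn_toLp, hG.coeFn_toLp⟩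

/-- Poincaré's inequality for test functions on a bounded open set. -/
lemma exists_poincare_test {Ω : Set Plane} (hΩ : IsOpen Ω) (hb : Bornology.IsBounded Ω) :
    ∃ C : ℝ, 0 ≤ C ∧ ∀ u ∈ testSubspace Ω, ‖u.1.fst‖ ^ 2 ≤ C * ‖W12.gradL Ω u‖ ^ 2 := by
  have A : (ℝ × ℝ) ≃L[ℝ] Plane := ContinuousLinearEquiv.ofFinrankEq (by simp)
  obtain ⟨C, hCt, hC⟩ := exists_lintegral_sq_le A
  have hvol : volume Ω ≠ ⊤ := hb.measure_lt_top.ne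
  set C' : ℝ≥0∞ := C * (4 * volume Ω) with hC'
  have hC't : C' ≠ ⊤ := by finiteness
  refine ⟨C'.toReal, ENNReal.toReal_nonneg, ?_⟩
  rintro u ⟨φ, hφ, hu⟩
  obtain ⟨v, hv, hgv⟩ := hφ.exists_W12
  obtain rfl : u = v := W12.ext hΩ (hu.trans hv.symm)
  have hφ1 : ContDiff ℝ 1 φ := hφ.smooth.of_le (by norm_cast)
  have hdc : Continuous (fderiv ℝ φ) := hφ1.continuous_fderiv one_ne_zero
  have hG : ∀ᵐ x ∂volume.restrict Ω, ‖fderiv ℝ φ x‖ₑ ≤ 2 * ‖W12.grad u x‖ₑ := by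
    filter_upwards [hgv] with x hx
    calc ‖fderiv ℝ φ x‖ₑ ≤ ∑ i, ‖fderiv ℝ φ x (EuclideanSpace.single i 1)‖ₑ :=
          enorm_le_sum_coord _
      _ ≤ ∑ _i : Fin 2, ‖W12.grad u x‖ₑ := by
          refine Finset.sum_le_sum fun i _ => enorm_le_iff_norm_le.2 ?_
          have := PiLp.norm_apply_le (W12.grad u x) i
          rwa [hx] at this ⊢
      _ = _ := by simp
  have h1 : ∫⁻ x in Ω, ‖φ x‖ₑ ^ 2 ≤ C * (∫⁻ x in Ω, ‖fderiv ℝ φ x‖ₑ) ^ 2 := by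
    have h := hC Set.univ MeasurableSet.univ (fun _ _ _ _ _ _ => trivial) φ hφ1
      hφ.hasCompactSupport
    rw [Measure.restrict_univ] at h
    rw [setLIntegral_eq_of_support_subset (f := fun x => ‖fderiv ℝ φ x‖ₑ)]
    · exact (lintegral_mono' Measure.restrict_le_self le_rfl).trans h
    · intro x hx
      refine hφ.tsupport_subset (support_fderiv_subset ℝ fun h => hx ?_)
      change ‖fderiv ℝ φ x‖ₑ = 0
      rw [← ofReal_norm, h, norm_zero, ENNReal.ofReal_zero]
  have h2 : (∫⁻ x in Ω, ‖fderiv ℝ φ x‖ₑ) ^ 2 ≤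
      4 * volume Ω * ∫⁻ x in Ω, ‖W12.grad u x‖ₑ ^ 2 := by
    have hcs := sq_lintegral_mul_le (volume.restrict Ω) hdc.measurable.enorm.aemeasurable
      (aemeasurable_const (b := (1 : ℝ≥0∞)))
    simp only [mul_one, one_pow, lintegral_const, one_mul, Measure.restrict_apply_univ] at hcs
    calc _ ≤ _ := hcs
      _ ≤ (∫⁻ x in Ω, 4 * ‖W12.grad u x‖ₑ ^ 2) * volume Ω := by
          gcongr ?_ * _
          refine lintegral_mono_ae ?_
          filter_upwards [hG] with x hx
          calc ‖fderiv ℝ φ x‖ₑ ^ 2 ≤ (2 * ‖W12.grad u x‖ₑ) ^ 2 := by gcongr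
            _ = _ := by rw [mul_pow]; norm_num
      _ = _ := by rw [lintegral_const_mul' _ _ (by simp)]; ring
  have h3 : ENNReal.ofReal (‖u.1.fst‖ ^ 2) ≤ ENNReal.ofReal (C'.toReal * ‖W12.gradL Ω u‖ ^ 2) := by
    rw [ENNReal.ofReal_mul ENNReal.toReal_nonneg, ENNReal.ofReal_toReal hC't,
      ofReal_norm_sq_Lp, ofReal_norm_sq_Lp]
    calc ∫⁻ x in Ω, ‖u.1.fst x‖ₑ ^ 2 = ∫⁻ x in Ω, ‖φ x‖ₑ ^ 2 := by
          refine lintegral_congr_ae ?_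
          filter_upwards [hu] with x hx
          rw [← hx]
          rfl
      _ ≤ C * (4 * volume Ω * ∫⁻ x in Ω, ‖W12.grad u x‖ₑ ^ 2) := h1.trans (by gcongr)
      _ = _ := by
          rw [hC', mul_assoc C]
          rfl
  exact (ENNReal.ofReal_le_ofReal_iff (by positivity)).1 h3

/-- On `W₀^{1,2}(Ω)` the norm is controlled by the norm of the gradient. -/
lemma exists_poincare {Ω : Set Plane} (hΩ : IsOpen Ω) (hb : Bornology.IsBounded Ω) :
    ∃ C : ℝ, 0 ≤ C ∧ ∀ u : W012 Ω, ‖u‖ ^ 2 ≤ C * ‖W12.gradL Ω u‖ ^ 2 := by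
  obtain ⟨C, hC0, hC⟩ := exists_poincare_test hΩ hb
  refine ⟨C + 1, by positivity, fun u => ?_⟩
  have hcl : IsClosed {u : W12 Ω | ‖u‖ ^ 2 ≤ (C + 1) * ‖W12.gradL Ω u‖ ^ 2} :=
    isClosed_le (by fun_prop) (by fun_prop)
  have hsub : closure (testSubspace Ω : Set (W12 Ω)) ⊆
      {u : W12 Ω | ‖u‖ ^ 2 ≤ (C + 1) * ‖W12.gradL Ω u‖ ^ 2} := by
    refine closure_minimal (fun v hv => ?_) hcl
    change ‖v‖ ^ 2 ≤ (C + 1) * ‖W12.gradL Ω v‖ ^ 2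
    rw [W12.norm_sq_eq]
    linarith [hC v hv]
  exact hsub u.2

/-- The Sobolev embedding `W^{1,2}(Ω) → L^p(Ω)`, followed by restriction to `K ⊆ Ω`, is a bounded
operator. -/
lemma W12.exists_embedding {Ω K : Set Plane} (hΩ : IsLipschitzDomain Ω)
    (hb : Bornology.IsBounded Ω) (hK : K ⊆ Ω) (p : ℝ≥0∞) [Fact (1 ≤ p)] (hp : p ≠ ⊤) :
    ∃ S : W12 Ω →L[ℝ] Lp ℝ p (volume.restrict K),
      ∀ w, S w =ᵐ[volume.restrict K] W12.fn w := by
  have hle : volume.restrict K ≤ volume.restrict Ω := Measure.restrict_mono_set _ hK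
  have hac := hle.absolutelyContinuous
  have hmem : ∀ w : W12 Ω, MemLp (W12.fn w) p (volume.restrict K) := fun w =>
    (W12.memLp hΩ hb w hp).mono_measure hle
  let T : W12 Ω →ₗ[ℝ] Lp ℝ p (volume.restrict K) :=
    { toFun := fun w => (hmem w).toLp
      map_add' := fun v w => by
        rw [← MemLp.toLp_add]
        exact MemLp.toLp_congr _ _ (hac.ae_eq (Lp.coeFn_add v.1.fst w.1.fst))
      map_smul' := fun c w => by
        rw [RingHom.id_apply, ← MemLp.toLp_const_smul]
        exact MemLp.toLp_congr _ _ (hac.ae_eq (Lp.coeFn_smul c w.1.fst)) }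
  have hT : ∀ w, T w =ᵐ[volume.restrict K] W12.fn w := fun w => (hmem w).coeFn_toLp
  refine ⟨⟨T, T.continuous_of_seq_closed_graph fun u x y hu hy => ?_⟩, hT⟩
  have h1 : TendstoInMeasure (volume.restrict K) (fun n => W12.fn (u n)) atTop y :=
    (tendstoInMeasure_of_tendsto_Lp hy).congr_left fun n => hT (u n)
  have hfst : Tendsto (fun n => (u n).1.fst) atTop (𝓝 x.1.fst) :=
    (((WithLp.continuous_fst 2 _ _).comp continuous_subtype_val).tendsto x).comp hu
  have h2 : TendstoInMeasure (volume.restrict K) (fun n => W12.fn (u n)) atTop (W12.fn x) := by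
    intro ε hε
    exact tendsto_of_tendsto_of_tendsto_of_le_of_le tendsto_const_nhds
      (tendstoInMeasure_of_tendsto_Lp hfst ε hε) (fun _ => zero_le) (fun _ => hle _)
  exact Lp.ext ((tendstoInMeasure_ae_unique h1 h2).trans (hT x).symm)

lemma energy_eq_ofReal {Ω K : Set Plane} {lam s : ℝ} (hlam : 0 ≤ lam) (hs : 0 < s)
    [Fact (1 ≤ ENNReal.ofReal s)]
    {S : W12 Ω → Lp ℝ (ENNReal.ofReal s) (volume.restrict K)}
    (hS : ∀ w, S w =ᵐ[volume.restrict K] W12.fn w) (w v : W12 Ω) :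
    energy Ω K lam s w v = ENNReal.ofReal (‖W12.gradL Ω v‖ ^ 2 + lam * ‖S v - S w‖ ^ s) := by
  have h1 : ∫⁻ x in Ω, ‖W12.grad v x‖ₑ ^ 2 = ENNReal.ofReal (‖W12.gradL Ω v‖ ^ 2) :=
    (ofReal_norm_sq_Lp (W12.gradL Ω v)).symm
  have h2 : ∫⁻ x in K, ‖W12.fn v x - W12.fn w x‖ₑ ^ s = ENNReal.ofReal (‖S v - S w‖ ^ s) := by
    rw [← ENNReal.ofReal_rpow_of_nonneg (norm_nonneg _) hs.le, ofReal_norm, Lp.enorm_def,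
      eLpNorm_eq_lintegral_rpow_enorm_toReal (by simpa using hs) ENNReal.ofReal_ne_top,
      ENNReal.toReal_ofReal hs.le, ← ENNReal.rpow_mul, one_div, inv_mul_cancel₀ hs.ne',
      ENNReal.rpow_one]
    refine lintegral_congr_ae ?_
    filter_upwards [Lp.coeFn_sub (S v) (S w), hS v, hS w] with x hx hv hw
    rw [hx, Pi.sub_apply, hw, hv]
  rw [energy, h1, h2, ENNReal.ofReal_add (by positivity) (by positivity), ENNReal.ofReal_mul hlam]

lemma energy_le_energy_iff {Ω K : Set Plane} {lam s : ℝ} (hlam : 0 ≤ lam) (hs : 0 < s)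
    [Fact (1 ≤ ENNReal.ofReal s)]
    {S : W12 Ω → Lp ℝ (ENNReal.ofReal s) (volume.restrict K)}
    (hS : ∀ w, S w =ᵐ[volume.restrict K] W12.fn w) (w u v : W12 Ω) :
    energy Ω K lam s w u ≤ energy Ω K lam s w v ↔
      ‖W12.gradL Ω u‖ ^ 2 + lam * ‖S u - S w‖ ^ s ≤
        ‖W12.gradL Ω v‖ ^ 2 + lam * ‖S v - S w‖ ^ s := by
  rw [energy_eq_ofReal hlam hs hS w u, energy_eq_ofReal hlam hs hS w v]
  exact ENNReal.ofReal_le_ofReal_iff (by positivity)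

end Inpainting

open Inpainting
set_option maxHeartbeats 1000000 in
/-- Existence and uniqueness of the minimizer for every datum, so that the inpainting operator
`I : W^{1,2}(Ω) → W₀^{1,2}(Ω)` is well defined, together with its continuity. -/
theorem proposition5p2 (Ω K : Set Plane) (hΩ : IsLipschitzDomain Ω)
    (hbdd : Bornology.IsBounded Ω) (hKΩ : K ⊆ Ω) (hK : NullMeasurableSet K volume)
    (hKpos : 0 < volume K) (lam s : ℝ) (hlam : 0 < lam) (hs : 1 < s) :
    ∃ I : W12 Ω → W012 Ω,
      (∀ (w : W12 Ω) (u : W012 Ω), IsMinimizer Ω K lam s w u ↔ u = I w) ∧ Continuous I := by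
  have hs0 : 0 < s := by linarith
  have : Fact (1 ≤ ENNReal.ofReal s) := ⟨by simpa using ENNReal.ofReal_le_ofReal hs.le⟩
  obtain ⟨S, hS⟩ := W12.exists_embedding hΩ hbdd hKΩ (ENNReal.ofReal s) ENNReal.ofReal_ne_top
  obtain ⟨c, hc0, hc⟩ := exists_poincare hΩ.isOpen hbdd
  obtain ⟨I, hI, hIc⟩ := exists_continuous_minimizer_submodule (W012 Ω) (W12.gradL Ω) S hlam hs.le
    hc hc0
  refine ⟨I, fun w u => ?_, hIc⟩
  rw [← hI w u]
  exact forall_congr' fun v => energy_le_energy_iff hlam.le hs0 hS w u v
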